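/- Identify a partition $\alpha$ with its Ferrers diagram, a finite order ideal $\alpha\subset(\mathbb{Z}_{\ge 0})^2$ with $|\alpha|$ elements; write $\emptyset$ for the empty partition and $(1)$ for the partition of $1$. For partitions $\mu_1,\mu_2,\mu_3$ let the three legs be $$L_1=\{(i,j,k):(j,k)\in\mu_1\},\quad L_2=\{(i,j,k):(k,i)\in\mu_2\},\quad L_3=\{(i,j,k):(i,j)\in\mu_3\}$$ in $(\mathbb{Z}_{\ge 0})^3$. A 3D partition with asymptotic legs $(\mu_1,\mu_2,\mu_3)$ is an order ideal $\pi\subset(\mathbb{Z}_{\ge 0})^3$ (componentwise order) containing $L_1\cup L_2\cup L_3$ and such that $\pi\setminus(L_1\cup L_2\cup L_3)$ is finite. Its normalized size is $$|\pi|=\sum_{b\in\pi}\bigl(1-\#\{r\in\{1,2,3\}: b\in L_r\}\bigr)\in\mathbb{Z},$$ a sum with finitely many nonzero terms. The topological vertex is the Laurent series $\mathsf V_{\mu_1\mu_2\mu_3}(p)=\sum_{\pi}p^{|\pi|}$, the sum being over all 3D partitions with asymptotic legs $(\mu_1,\mu_2,\mu_3)$; it is nonzero. For $a\ge 0$ put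 $$F(a)=\sum_{\alpha\vdash a}(1-p)\,\frac{\mathsf V_{\emptyset(1)\alpha}(p)}{\mathsf V_{\emptyset\emptyset\alpha}(p)}\in\mathbb{Q}((p)).$$ **Lemma.** In $\mathbb{Q}((p))[[q]]$, with its $q$-adic topology, the following sum over all partitions $\alpha$ and the following infinite product converge, and $$\sum_{a=0}^{\infty}F(a)\,q^a=\sum_{\alpha}q^{|\alpha|}\,(1-p)\,\frac{\mathsf V_{\emptyset(1)\alpha}(p)}{\mathsf V_{\emptyset\emptyset\alpha}(p)}=\prod_{m=1}^{\infty}\frac{1-q^m}{(1-pq^m)(1-p^{-1}q^m)}.$$ -/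

import Mathlib

namespace TopVertex

/-! Partitions are identified with their Ferrers diagrams, i.e. finite lower sets of `ℕ × ℕ`
(Mathlib's `YoungDiagram`); the size `|α|` is `α.card`. The empty partition is `⊥`. -/

/-- The partition `(1)`, whose diagram is the single box `(0, 0)`. -/
def oneBox : YoungDiagram where
  cells := {(0, 0)}
  isLowerSet := by
    intro a b hba ha
    simp only [Finset.coe_singleton, Set.mem_singleton_iff] at ha ⊢
    subst ha
    exact le_antisymm hba bot_le

/-- The leg along the first coordinate axis with cross-section `μ`. -/
def leg₁ (μ : YoungDiagram) : Set (ℕ × ℕ × ℕ) := {b | (b.2.1, b.2.2) ∈ μ}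

/-- The leg along the second coordinate axis with cross-section `μ`. -/
def leg₂ (μ : YoungDiagram) : Set (ℕ × ℕ × ℕ) := {b | (b.2.2, b.1) ∈ μ}

/-- The leg along the third coordinate axis with cross-section `μ`. -/
def leg₃ (μ : YoungDiagram) : Set (ℕ × ℕ × ℕ) := {b | (b.1, b.2.1) ∈ μ}

/-- The union of the three legs: the smallest 3D partition with these asymptotic legs. -/
def legs (μ₁ μ₂ μ₃ : YoungDiagram) : Set (ℕ × ℕ × ℕ) := leg₁ μ₁ ∪ leg₂ μ₂ ∪ leg₃ μ₃

open Classical in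
/-- The number of legs that contain the box `b`. -/
noncomputable def legMult (μ₁ μ₂ μ₃ : YoungDiagram) (b : ℕ × ℕ × ℕ) : ℕ :=
  (if b ∈ leg₁ μ₁ then 1 else 0) + (if b ∈ leg₂ μ₂ then 1 else 0) +
    (if b ∈ leg₃ μ₃ then 1 else 0)

/-- `π` is a 3D partition with asymptotic legs `(μ₁, μ₂, μ₃)`: an order ideal of `ℕ³` obtained by
adding finitely many boxes to the union of the three legs. -/
structure IsThreeDPartition (μ₁ μ₂ μ₃ : YoungDiagram) (π : Set (ℕ × ℕ × ℕ)) : Prop where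
  isLowerSet : IsLowerSet π
  legs_subset : legs μ₁ μ₂ μ₃ ⊆ π
  finite_diff : (π \ legs μ₁ μ₂ μ₃).Finite

/-- The total overlap of the legs: each box contained in `k ≥ 1` legs contributes `k - 1`
(and boxes in no leg contribute `0 - 1 = 0`). Only finitely many boxes lie in two legs. -/
noncomputable def overlap (μ₁ μ₂ μ₃ : YoungDiagram) : ℕ :=
  ∑ᶠ b : ℕ × ℕ × ℕ, (legMult μ₁ μ₂ μ₃ b - 1)

/-- The normalized size `|π| = ∑_{b ∈ π} (1 - #{legs containing b})` of a 3D partition with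
asymptotic legs: boxes outside the legs contribute `1`, and a box in `k` legs contributes
`1 - k`. -/
noncomputable def normSize (μ₁ μ₂ μ₃ : YoungDiagram) (π : Set (ℕ × ℕ × ℕ)) : ℤ :=
  ((π \ legs μ₁ μ₂ μ₃).ncard : ℤ) - (overlap μ₁ μ₂ μ₃ : ℤ)

/-- The 3D partitions with asymptotic legs `(μ₁, μ₂, μ₃)` and normalized size `n`. -/
def threeDPartitions (μ₁ μ₂ μ₃ : YoungDiagram) (n : ℤ) : Set (Set (ℕ × ℕ × ℕ)) :=
  {π | IsThreeDPartition μ₁ μ₂ μ₃ π ∧ normSize μ₁ μ₂ μ₃ π = n}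

theorem threeDPartitions_eq_empty (μ₁ μ₂ μ₃ : YoungDiagram) (n : ℤ)
    (hn : n < -(overlap μ₁ μ₂ μ₃ : ℤ)) : threeDPartitions μ₁ μ₂ μ₃ n = ∅ := by
  ext π
  simp only [threeDPartitions, normSize, Set.mem_ofPred_eq, Set.mem_empty_iff_false, iff_false]
  rintro ⟨-, h⟩
  omega

/-- A common bound for the coordinates of the boxes of three partitions. -/
theorem exists_bound (μ₁ μ₂ μ₃ : YoungDiagram) :
    ∃ B : ℕ, ∀ i j : ℕ, ((i, j) ∈ μ₁ ∨ (i, j) ∈ μ₂ ∨ (i, j) ∈ μ₃) → i < B ∧ j < B := by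
  classical
  let s := μ₁.cells ∪ μ₂.cells ∪ μ₃.cells
  refine ⟨s.sup (fun x => x.1 + x.2) + 1, fun i j h => ?_⟩
  have hmem : (i, j) ∈ s := by
    simp only [s, Finset.mem_union, YoungDiagram.mem_cells]
    tauto
  have := Finset.le_sup (f := fun x : ℕ × ℕ => x.1 + x.2) hmem
  simp only at this
  omega

/-- Only finitely many boxes contribute to the overlap. -/
theorem finite_support_overlap (μ₁ μ₂ μ₃ : YoungDiagram) :
    (Function.support fun b : ℕ × ℕ × ℕ => legMult μ₁ μ₂ μ₃ b - 1).Finite := by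
  classical
  obtain ⟨B, hB⟩ := exists_bound μ₁ μ₂ μ₃
  refine ((Set.finite_Iio B).prod ((Set.finite_Iio B).prod (Set.finite_Iio B))).subset ?_
  rintro ⟨i, j, k⟩ hb
  have h1 : (j, k) ∈ μ₁ → j < B ∧ k < B := fun h => hB _ _ (Or.inl h)
  have h2 : (k, i) ∈ μ₂ → k < B ∧ i < B := fun h => hB _ _ (Or.inr (Or.inl h))
  have h3 : (i, j) ∈ μ₃ → i < B ∧ j < B := fun h => hB _ _ (Or.inr (Or.inr h))
  simp only [Function.mem_support, legMult, leg₁, leg₂, leg₃, Set.mem_ofPred_eq] at hb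
  show i < B ∧ j < B ∧ k < B
  by_cases c1 : (j, k) ∈ μ₁ <;> by_cases c2 : (k, i) ∈ μ₂ <;> by_cases c3 : (i, j) ∈ μ₃ <;>
    simp_all

/-- For each size there are finitely many 3D partitions with the given legs, so that counting
them by `Set.ncard` is meaningful. -/
theorem finite_threeDPartitions (μ₁ μ₂ μ₃ : YoungDiagram) (n : ℤ) :
    (threeDPartitions μ₁ μ₂ μ₃ n).Finite := by
  classical
  obtain ⟨B, hB⟩ := exists_bound μ₁ μ₂ μ₃
  set L := legs μ₁ μ₂ μ₃ with hL
  set N := (n + overlap μ₁ μ₂ μ₃).toNat with hN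
  have key : ∀ π ∈ threeDPartitions μ₁ μ₂ μ₃ n, ∀ f : ℕ → ℕ × ℕ × ℕ, Function.Injective f →
      ∀ i, (∀ t ≤ i, f t ∈ π) → (∀ t, B ≤ t → t ≤ i → f t ∉ L) → i < N + B := by
    intro π hπ f hf i h1 h2
    by_contra hcon
    push Not at hcon
    have hsub : ((Finset.Icc B i).image f : Set (ℕ × ℕ × ℕ)) ⊆ π \ L := by
      intro b hb
      simp only [Finset.coe_image, Set.mem_image, Finset.mem_coe, Finset.mem_Icc] at hb
      obtain ⟨t, ⟨ht1, ht2⟩, rfl⟩ := hb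
      exact ⟨h1 t ht2, h2 t ht1 ht2⟩
    have hc := Set.ncard_le_ncard hsub hπ.1.finite_diff
    rw [Set.ncard_coe_finset, Finset.card_image_of_injective _ hf, Nat.card_Icc] at hc
    have hs := hπ.2
    simp only [normSize] at hs
    rw [← hL] at hs
    omega
  have hfin : (Set.Iio (N + B) ×ˢ (Set.Iio (N + B) ×ˢ Set.Iio (N + B)) :
      Set (ℕ × ℕ × ℕ)).Finite :=
    (Set.finite_Iio _).prod ((Set.finite_Iio _).prod (Set.finite_Iio _))
  refine Set.Finite.of_finite_image (f := fun π => π \ L)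
    (hfin.finite_subsets.subset ?_) ?_
  · rintro _ ⟨π, hπ, rfl⟩
    rintro ⟨i, j, k⟩ ⟨hb, hbL⟩
    have hlow := hπ.1.isLowerSet
    simp only [hL, legs, leg₁, leg₂, leg₃, Set.mem_union, Set.mem_ofPred_eq, not_or] at hbL
    obtain ⟨⟨hb1, hb2⟩, hb3⟩ := hbL
    refine ⟨?_, ?_, ?_⟩
    · refine key π hπ (fun t => (t, j, k)) (fun a b h => by simpa using h) i ?_ ?_
      · intro t ht
        exact hlow (show ((t, j, k) : ℕ × ℕ × ℕ) ≤ (i, j, k) from ⟨ht, le_rfl⟩) hb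
      · intro t ht _
        simp only [hL, legs, leg₁, leg₂, leg₃, Set.mem_union, Set.mem_ofPred_eq, not_or]
        refine ⟨⟨hb1, fun h => ?_⟩, fun h => ?_⟩
        · have := hB _ _ (Or.inr (Or.inl h)); omega
        · have := hB _ _ (Or.inr (Or.inr h)); omega
    · refine key π hπ (fun t => (i, t, k)) (fun a b h => by simpa using h) j ?_ ?_
      · intro t ht
        exact hlow (show ((i, t, k) : ℕ × ℕ × ℕ) ≤ (i, j, k) from ⟨le_rfl, ht, le_rfl⟩) hb
      · intro t ht _
        simp only [hL, legs, leg₁, leg₂, leg₃, Set.mem_union, Set.mem_ofPred_eq, not_or]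
        refine ⟨⟨fun h => ?_, hb2⟩, fun h => ?_⟩
        · have := hB _ _ (Or.inl h); omega
        · have := hB _ _ (Or.inr (Or.inr h)); omega
    · refine key π hπ (fun t => (i, j, t)) (fun a b h => by simpa using h) k ?_ ?_
      · intro t ht
        exact hlow (show ((i, j, t) : ℕ × ℕ × ℕ) ≤ (i, j, k) from ⟨le_rfl, le_rfl, ht⟩) hb
      · intro t ht _
        simp only [hL, legs, leg₁, leg₂, leg₃, Set.mem_union, Set.mem_ofPred_eq, not_or]
        refine ⟨⟨fun h => ?_, fun h => ?_⟩, hb3⟩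
        · have := hB _ _ (Or.inl h); omega
        · have := hB _ _ (Or.inr (Or.inl h)); omega
  · intro π hπ ρ hρ h
    have h' : π \ L = ρ \ L := h
    rw [← Set.sdiff_union_of_subset hπ.1.legs_subset, ← Set.sdiff_union_of_subset hρ.1.legs_subset,
      ← hL, h']

/-- The topological vertex `V_{μ₁ μ₂ μ₃}(p) = ∑_π p^{|π|}`, a Laurent series in `p`: the generating
function of 3D partitions with asymptotic legs `(μ₁, μ₂, μ₃)`. -/
noncomputable def vertex (μ₁ μ₂ μ₃ : YoungDiagram) : LaurentSeries ℚ :=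
  HahnSeries.ofSuppBddBelow (fun n : ℤ => ((threeDPartitions μ₁ μ₂ μ₃ n).ncard : ℚ))
    ⟨-(overlap μ₁ μ₂ μ₃ : ℤ), by
      intro n hn
      by_contra hlt
      push Not at hlt
      exact hn (by simp [threeDPartitions_eq_empty μ₁ μ₂ μ₃ n hlt])⟩

/-- The variable `p` of the field of Laurent series. -/
noncomputable def p : LaurentSeries ℚ := HahnSeries.single 1 1

/-- The ratio `(1 - p) · V_{∅ (1) α}(p) / V_{∅ ∅ α}(p)` in the field of Laurent series. -/
noncomputable def vertexRatio (α : YoungDiagram) : LaurentSeries ℚ :=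
  (1 - p) * (vertex ⊥ oneBox α / vertex ⊥ ⊥ α)

/-- The denominators `V_{∅ ∅ α}(p)` are nonzero: the number of 3D partitions of minimal
normalized size is `1`. -/
theorem vertex_ne_zero (μ₁ μ₂ μ₃ : YoungDiagram) : vertex μ₁ μ₂ μ₃ ≠ 0 := by
  intro h
  have h0 : (vertex μ₁ μ₂ μ₃).coeff (-(overlap μ₁ μ₂ μ₃ : ℤ)) = 0 := by rw [h]; rfl
  have h1 : ((threeDPartitions μ₁ μ₂ μ₃ (-(overlap μ₁ μ₂ μ₃ : ℤ))).ncard : ℚ) = 0 := h0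
  rw [Nat.cast_eq_zero, Set.ncard_eq_zero (finite_threeDPartitions _ _ _ _)] at h1
  have hmem : legs μ₁ μ₂ μ₃ ∈ threeDPartitions μ₁ μ₂ μ₃ (-(overlap μ₁ μ₂ μ₃ : ℤ)) := by
    refine ⟨⟨?_, le_rfl, by simp⟩, by simp [normSize]⟩
    rintro ⟨i, j, k⟩ ⟨i', j', k'⟩ ⟨hi, hj, hk⟩ hb
    simp only [legs, leg₁, leg₂, leg₃, Set.mem_union, Set.mem_ofPred_eq] at hb ⊢
    simp only at hi hj hk
    rcases hb with (hb | hb) | hb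
    · exact Or.inl (Or.inl (μ₁.up_left_mem hj hk hb))
    · exact Or.inl (Or.inr (μ₂.up_left_mem hk hi hb))
    · exact Or.inr (μ₃.up_left_mem hi hj hb)
  rw [h1] at hmem
  exact hmem

/-- There are finitely many partitions of each size. -/
theorem finite_card_eq (a : ℕ) : {α : YoungDiagram | α.card = a}.Finite := by
  classical
  refine Set.Finite.of_finite_image (f := YoungDiagram.cells)
    (((Finset.range a ×ˢ Finset.range a).powerset.finite_toSet).subset ?_) ?_
  · rintro _ ⟨α, hα, rfl⟩
    simp only [Finset.coe_powerset, Set.mem_preimage, Set.mem_powerset_iff]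
    rintro ⟨i, j⟩ hij
    have hij' : (i, j) ∈ α := hij
    have hα' : α.cells.card = a := hα
    simp only [Finset.coe_product, Finset.coe_range, Set.mem_prod, Set.mem_Iio]
    constructor
    · have hs : (Finset.range (i + 1)).image (fun t => (t, j)) ⊆ α.cells := by
        intro x hx
        obtain ⟨t, ht, rfl⟩ := Finset.mem_image.1 hx
        exact α.up_left_mem (Nat.lt_succ_iff.1 (Finset.mem_range.1 ht)) le_rfl hij'
      have := Finset.card_le_card hs
      rw [Finset.card_image_of_injective _ (fun a b h => by simpa using h),
        Finset.card_range] at this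
      omega
    · have hs : (Finset.range (j + 1)).image (fun t => (i, t)) ⊆ α.cells := by
        intro x hx
        obtain ⟨t, ht, rfl⟩ := Finset.mem_image.1 hx
        exact α.up_left_mem le_rfl (Nat.lt_succ_iff.1 (Finset.mem_range.1 ht)) hij'
      have := Finset.card_le_card hs
      rw [Finset.card_image_of_injective _ (fun a b h => by simpa using h),
        Finset.card_range] at this
      omega
  · intro α _ β _ h
    exact YoungDiagram.ext h

/-- `F(a) = ∑_{α ⊢ a} (1 - p) · V_{∅ (1) α}(p) / V_{∅ ∅ α}(p)`. -/
noncomputable def F (a : ℕ) : LaurentSeries ℚ :=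
  ∑ α ∈ (finite_card_eq a).toFinset, vertexRatio α

/-- The `q`-adic topology on power series in `q` with coefficients Laurent series in `p`: the
topology of coefficientwise convergence, for the discrete topology on the coefficients. -/
@[reducible]
def qAdicTopology : TopologicalSpace (PowerSeries (LaurentSeries ℚ)) :=
  @PowerSeries.WithPiTopology.instTopologicalSpace (LaurentSeries ℚ) ⊥

end TopVertex

attribute [local instance] TopVertex.qAdicTopology

namespace TopVertex

/-! With no second leg, a 3D partition is an array of column heights over the complement of `α`, a
skew plane partition. Inside an `a × b` rectangle, toggling diagonals while corners are absorbed
into `α` turns these arrays into arbitrary arrays of naturals graded by hook lengths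
(`exists_bijOn_hook`). Their generating function is therefore the product of 1/(1 - p^hook) over the
boxes outside `α`.

A single-box second leg forces the heights along row 0 to be positive. Cut off at width b + 1 this
says h(0, b) ≠ 0, so the count is the difference of the counts for widths b + 1 and b. The two
products differ only by the hooks of the last column, of lengths b + 1 + i - λ_i. Keeping the linear
terms and removing the shift b + 1 gives V_{∅(1)α} / V_{∅∅α} = ∑_{i ≥ 0} p^(i - λ_i); times 1 - p
this is `ratioOfParts` (`one_sub_p_mul_vertex`).

Let G_N be the generating function of this ratio over partitions with parts at most N, and P_N that
of the constant 1. Splitting off a first part N gives G_N (1 - p q^N) = G_{N-1} + (1 - p)(q/p)^N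
P_N. Hence G_N ∏_{m ≤ N} (1 - p q^m) = ∑_{j ≤ N} (p;q)_j/(q;q)_j (q/p)^j, and the q-binomial theorem
evaluates the right side as ∏ (1 - q^m)/(1 - q^m/p) modulo q^(N+1). A given power of q sees only
finitely many factors, whence the convergence. -/

/-! ### Diagonal toggles of skew plane partitions -/

/-- Skew plane partitions: functions supported on the part of the `a × b` rectangle outside the
diagram `α` that are weakly decreasing in both directions outside `α`. -/
def skewPP (a b : ℕ) (α : YoungDiagram) : Set (ℕ × ℕ → ℕ) :=
  {h | (∀ x y, h (x, y) ≠ 0 → (x < a ∧ y < b) ∧ (x, y) ∉ α) ∧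
    ∀ x y, (x, y) ∉ α → h (x + 1, y) ≤ h (x, y) ∧ h (x, y + 1) ≤ h (x, y)}

/-- Functions supported on the part of the `a × b` rectangle outside `α`. -/
def skewFun (a b : ℕ) (α : YoungDiagram) : Set (ℕ × ℕ → ℕ) :=
  {g | ∀ x y, g (x, y) ≠ 0 → (x < a ∧ y < b) ∧ (x, y) ∉ α}

/-- The weight of `h` when a box of content `u` has weight `W (u + 1) - W u`. -/
def contentWeight (a b : ℕ) (W : ℤ → ℤ) (h : ℕ × ℕ → ℕ) : ℤ :=
  ∑ z ∈ Finset.range a ×ˢ Finset.range b,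
    (h z : ℤ) * (W ((z.2 : ℤ) - z.1 + 1) - W ((z.2 : ℤ) - z.1))

/-- The toggle of `h` along the diagonal that starts at `(r, c)`, with new value `v` at `(r, c)`. -/
def toggle (r c v : ℕ) (h : ℕ × ℕ → ℕ) (z : ℕ × ℕ) : ℕ :=
  if z = (r, c) then v else
    if r < z.1 ∧ z.2 + r = z.1 + c then
      min (h (z.1 - 1, z.2)) (h (z.1, z.2 - 1)) + max (h (z.1 + 1, z.2)) (h (z.1, z.2 + 1)) - h z
    else h z

/-- The excess of `h` at the box `(r, c)` over its successors. -/
def peak (r c : ℕ) (h : ℕ × ℕ → ℕ) : ℕ := h (r, c) - max (h (r + 1, c)) (h (r, c + 1))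

section Toggle

variable {r c : ℕ}

theorem toggle_corner (v : ℕ) (h : ℕ × ℕ → ℕ) : toggle r c v h (r, c) = v := by simp [toggle]

theorem toggle_diag (v : ℕ) (h : ℕ × ℕ → ℕ) (s : ℕ) :
    toggle r c v h (r + s + 1, c + s + 1) =
      min (h (r + s, c + s + 1)) (h (r + s + 1, c + s)) +
        max (h (r + s + 1 + 1, c + s + 1)) (h (r + s + 1, c + s + 1 + 1)) -
        h (r + s + 1, c + s + 1) := by
  unfold toggle
  rw [if_neg (by simp; omega), if_pos ⟨by simp only; omega, by simp only; omega⟩]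
  simp

theorem toggle_off (v : ℕ) (h : ℕ × ℕ → ℕ) {x y : ℕ} (hxy : y + r ≠ x + c) :
    toggle r c v h (x, y) = h (x, y) := by
  unfold toggle
  rw [if_neg (by simp; omega), if_neg (by simp; omega)]

variable {a b : ℕ} {α β : YoungDiagram}

theorem not_mem_of_le_of_not_mem {x y x' y' : ℕ} (h : (x, y) ∉ α) (hx : x ≤ x') (hy : y ≤ y') :
    (x', y') ∉ α := fun h' => h (α.up_left_mem hx hy h')

/-- `β` is `α` with the box `(r, c)` added. -/
def IsAddBox (α β : YoungDiagram) (r c : ℕ) : Prop :=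
  (r, c) ∉ α ∧ ∀ z, z ∈ β ↔ z ∈ α ∨ z = (r, c)

namespace IsAddBox

theorem lt_of_not_mem (H : IsAddBox α β r c) {x y : ℕ} (h : (x, y) ∉ β) : r < x ∨ c < y := by
  by_contra hc
  push Not at hc
  exact h (β.up_left_mem hc.1 hc.2 ((H.2 _).2 (Or.inr rfl)))

theorem not_mem_right (H : IsAddBox α β r c) {x y : ℕ} (h : (x, y) ∉ β) : (x, y) ∉ α :=
  fun h' => h ((H.2 _).2 (Or.inl h'))

theorem not_mem_of_lt (H : IsAddBox α β r c) {x y : ℕ} (hx : r ≤ x) (hy : c ≤ y)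
    (hne : r < x ∨ c < y) : (x, y) ∉ β := by
  intro h
  rcases (H.2 _).1 h with h | h
  · exact not_mem_of_le_of_not_mem H.1 hx hy h
  · simp at h; omega

theorem le_of_not_mem (H : IsAddBox α β r c) {x y : ℕ} (h : (x, y) ∉ α) :
    (x = r ∧ y = c) ∨ r < x ∨ c < y := by
  by_cases h' : (x, y) = (r, c)
  · left; simpa using h'
  · right; exact H.lt_of_not_mem (fun h2 => ((H.2 _).1 h2).elim h h')

end IsAddBox

/-- Beyond the corner, a diagonal entry lies between the maximum of its two successors and the
minimum of its two predecessors. The toggle reflects it in that interval, and the neighbouring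
diagonals do not move. The corner lies in `β` and is never compared, so `v` is arbitrary. -/
theorem toggle_antitone (H : IsAddBox α β r c) (v : ℕ) {h : ℕ × ℕ → ℕ}
    (hh : ∀ x y, (x, y) ∉ β → h (x + 1, y) ≤ h (x, y) ∧ h (x, y + 1) ≤ h (x, y))
    (x y : ℕ) (hxy : (x, y) ∉ β) :
    toggle r c v h (x + 1, y) ≤ toggle r c v h (x, y) ∧
      toggle r c v h (x, y + 1) ≤ toggle r c v h (x, y) := by
  have hlt := H.lt_of_not_mem hxy
  by_cases hd : y + r = x + c
  · obtain ⟨s, rfl, rfl⟩ : ∃ s, x = r + s + 1 ∧ y = c + s + 1 :=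
      ⟨x - r - 1, by omega, by omega⟩
    have h1 := (hh (r + s) (c + s + 1) (H.not_mem_of_lt (by omega) (by omega) (by omega))).1
    have h2 := (hh (r + s + 1) (c + s) (H.not_mem_of_lt (by omega) (by omega) (by omega))).2
    rw [toggle_off v h (x := r + s + 1 + 1) (by omega),
      toggle_off v h (y := c + s + 1 + 1) (by omega), toggle_diag]
    omega
  · rw [toggle_off v h hd]
    constructor
    · by_cases hd' : y + r = x + 1 + c
      · obtain ⟨s, rfl, rfl⟩ : ∃ s, x = r + s ∧ y = c + s + 1 := ⟨x - r, by omega, by omega⟩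
        have h1 := hh (r + s + 1) (c + s + 1) (H.not_mem_of_lt (by omega) (by omega) (by omega))
        rw [toggle_diag]
        omega
      · rw [toggle_off v h (by omega)]
        exact (hh x y hxy).1
    · by_cases hd' : y + 1 + r = x + c
      · obtain ⟨s, rfl, rfl⟩ : ∃ s, x = r + s + 1 ∧ y = c + s := ⟨x - r - 1, by omega, by omega⟩
        have h1 := hh (r + s + 1) (c + s + 1) (H.not_mem_of_lt (by omega) (by omega) (by omega))
        rw [toggle_diag]
        omega
      · rw [toggle_off v h (by omega)]
        exact (hh x y hxy).2

theorem toggle_support (H : IsAddBox α β r c) (v : ℕ) {h : ℕ × ℕ → ℕ}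
    (hh : ∀ x y, h (x, y) ≠ 0 → (x < a ∧ y < b) ∧ (x, y) ∉ α) (x y : ℕ)
    (hne : (x, y) ≠ (r, c)) (h0 : toggle r c v h (x, y) ≠ 0) :
    (x < a ∧ y < b) ∧ (x, y) ∉ β := by
  have hz : ∀ x y, ¬ (x < a ∧ y < b) → h (x, y) = 0 := fun x y hn => by
    by_contra hc; exact hn (hh x y hc).1
  by_cases hd : r < x ∧ y + r = x + c
  · obtain ⟨s, rfl, rfl⟩ : ∃ s, x = r + s + 1 ∧ y = c + s + 1 :=
      ⟨x - r - 1, by omega, by omega⟩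
    refine ⟨?_, H.not_mem_of_lt (by omega) (by omega) (by omega)⟩
    by_contra hc
    apply h0
    -- Outside the rectangle both successors and at least one predecessor vanish, so min + max - h
    -- is zero.
    rw [toggle_diag, hz (r + s + 1 + 1) _ (by omega), hz _ (c + s + 1 + 1) (by omega)]
    rcases not_and_or.1 hc with hc | hc
    · rw [hz (r + s + 1) (c + s) (by omega)]; simp
    · rw [hz (r + s) (c + s + 1) (by omega)]; simp
  · have : toggle r c v h (x, y) = h (x, y) := by
      unfold toggle
      rw [if_neg hne, if_neg hd]
    rw [this] at h0
    refine ⟨(hh x y h0).1, fun hb => ?_⟩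
    exact ((H.2 _).1 hb).elim (hh x y h0).2 hne

/-- The interval of reflection is read off the neighbouring diagonals, which the toggle fixes, so
reflecting twice is the identity. Only the corner value is lost and has to be supplied. -/
theorem toggle_toggle (H : IsAddBox α β r c) (v v' : ℕ) {h : ℕ × ℕ → ℕ}
    (hh : ∀ x y, (x, y) ∉ β → h (x + 1, y) ≤ h (x, y) ∧ h (x, y + 1) ≤ h (x, y))
    (hv : h (r, c) = v') : toggle r c v' (toggle r c v h) = h := by
  funext ⟨x, y⟩
  by_cases hrc : (x, y) = (r, c)
  · rw [hrc, toggle_corner, hv]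
  by_cases hd : r < x ∧ y + r = x + c
  · obtain ⟨s, rfl, rfl⟩ : ∃ s, x = r + s + 1 ∧ y = c + s + 1 :=
      ⟨x - r - 1, by omega, by omega⟩
    have h1 := (hh (r + s) (c + s + 1) (H.not_mem_of_lt (by omega) (by omega) (by omega))).1
    have h2 := (hh (r + s + 1) (c + s) (H.not_mem_of_lt (by omega) (by omega) (by omega))).2
    rw [toggle_diag, toggle_off v h (by omega), toggle_off v h (by omega),
      toggle_off v h (by omega), toggle_off v h (by omega), toggle_diag]
    omega
  · have : ∀ v h, toggle r c v h (x, y) = h (x, y) := by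
      intro v h
      unfold toggle
      rw [if_neg hrc, if_neg hd]
    rw [this, this]

theorem skewPP_antitone_off (H : IsAddBox α β r c) {h : ℕ × ℕ → ℕ} (hh : h ∈ skewPP a b α)
    (x y : ℕ) (hxy : (x, y) ∉ β) : h (x + 1, y) ≤ h (x, y) ∧ h (x, y + 1) ≤ h (x, y) :=
  hh.2 x y (H.not_mem_right hxy)

theorem toggle_mem (H : IsAddBox α β r c) {h : ℕ × ℕ → ℕ} (hh : h ∈ skewPP a b α) :
    toggle r c 0 h ∈ skewPP a b β := by
  refine ⟨fun x y h0 => toggle_support H 0 hh.1 x y ?_ h0,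
    toggle_antitone H 0 (skewPP_antitone_off H hh)⟩
  intro h'
  rw [h', toggle_corner] at h0
  exact h0 rfl

/-- The inverse toggle refills the corner so that it exceeds its larger successor by `n`, the
prescribed peak. -/
theorem untoggle_mem (H : IsAddBox α β r c) (hr : r < a) (hc : c < b) {g : ℕ × ℕ → ℕ}
    (hg : g ∈ skewPP a b β) (n : ℕ) :
    toggle r c (n + max (g (r + 1, c)) (g (r, c + 1))) g ∈ skewPP a b α := by
  constructor
  · intro x y h0
    by_cases hrc : (x, y) = (r, c)
    · rw [hrc]
      simp only [Prod.mk.injEq] at hrc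
      exact ⟨⟨by omega, by omega⟩, H.1⟩
    · have := toggle_support H _ (fun x y h => ⟨(hg.1 x y h).1, H.not_mem_right (hg.1 x y h).2⟩)
        x y hrc h0
      exact ⟨this.1, H.not_mem_right this.2⟩
  · intro x y hxy
    by_cases hrc : (x, y) = (r, c)
    · simp only [Prod.mk.injEq] at hrc
      obtain ⟨rfl, rfl⟩ := hrc
      rw [toggle_corner, toggle_off _ g (by omega), toggle_off _ g (by omega)]
      omega
    · exact toggle_antitone H _ hg.2 x y (fun h => ((H.2 _).1 h).elim hxy hrc)

/-- Comparing `P` with `φ` only where `f` is nonzero lets the parametrised diagonal run past the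
rectangle. -/
theorem sum_diagonal_eq (f : ℕ × ℕ → ℕ) (hf : ∀ x y, f (x, y) ≠ 0 → x < a ∧ y < b)
    (P : ℕ × ℕ → Prop) [DecidablePred P] (φ : ℕ → ℕ × ℕ) (hφ : Function.Injective φ) (N : ℕ)
    (hP : ∀ z, f z ≠ 0 → (P z ↔ ∃ s < N, z = φ s)) :
    ∑ z ∈ (Finset.range a ×ˢ Finset.range b) with P z, f z = ∑ s ∈ Finset.range N, f (φ s) := by
  classical
  rw [← Finset.sum_image (f := f) (s := Finset.range N) (g := φ) (fun x _ y _ h => hφ h)]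
  refine Finset.sum_bij_ne_zero (fun z _ _ => z) ?_ ?_ ?_ ?_
  · intro z hz h0
    obtain ⟨s, hs, rfl⟩ := (hP z h0).1 (Finset.mem_filter.1 hz).2
    exact Finset.mem_image_of_mem _ (Finset.mem_range.2 hs)
  · intros; assumption
  · intro z hz h0
    obtain ⟨s, hs, rfl⟩ := Finset.mem_image.1 hz
    refine ⟨_, ?_, h0, rfl⟩
    have := hf _ _ h0
    rw [Finset.mem_filter, Finset.mem_product, Finset.mem_range, Finset.mem_range]
    exact ⟨this, (hP _ h0).2 ⟨s, Finset.mem_range.1 hs, rfl⟩⟩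
  · intros; rfl

/-- An old entry plus its toggled value is min + max. The max at one step and the min at the next
involve the same two neighbours, so together they give their sum; the corner contributes `peak` by
definition. -/
theorem sum_toggle_diag (H : IsAddBox α β r c) {h : ℕ × ℕ → ℕ} (hh : h ∈ skewPP a b α) (N : ℕ) :
    ∑ s ∈ Finset.range (N + 1), (toggle r c 0 h (r + s, c + s) + h (r + s, c + s)) =
      peak r c h + ∑ s ∈ Finset.range N, (h (r + s + 1, c + s) + h (r + s, c + s + 1)) +
        max (h (r + N + 1, c + N)) (h (r + N, c + N + 1)) := by
  induction N with
  | zero =>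
    have := hh.2 r c H.1
    simp only [zero_add, Finset.range_one, Finset.sum_singleton, add_zero, toggle_corner, peak,
      Finset.range_zero, Finset.sum_empty]
    omega
  | succ N ih =>
    rw [Finset.sum_range_succ, ih, Finset.sum_range_succ, ← add_assoc r N 1, ← add_assoc c N 1,
      toggle_diag]
    have h1 := (hh.2 (r + N) (c + N + 1) (H.not_mem_right
      (H.not_mem_of_lt (by omega) (by omega) (by omega)))).1
    have h2 := (hh.2 (r + N + 1) (c + N) (H.not_mem_right
      (H.not_mem_of_lt (by omega) (by omega) (by omega)))).2
    omega

/-- The total of `h` over the boxes of content `u`. -/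
def trace (a b : ℕ) (u : ℤ) (h : ℕ × ℕ → ℕ) : ℕ :=
  ∑ z ∈ (Finset.range a ×ˢ Finset.range b) with (((z : ℕ × ℕ).2 : ℤ) - z.1 = u), h z

theorem trace_toggle_off {u : ℤ} (hu : u ≠ (c : ℤ) - r) (v : ℕ) (h : ℕ × ℕ → ℕ) :
    trace a b u (toggle r c v h) = trace a b u h := by
  refine Finset.sum_congr rfl fun z hz => ?_
  have := (Finset.mem_filter.1 hz).2
  exact toggle_off v h (by omega)

theorem trace_toggle (H : IsAddBox α β r c) {h : ℕ × ℕ → ℕ} (hh : h ∈ skewPP a b α) :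
    peak r c h + trace a b ((c : ℤ) - r + 1) h + trace a b ((c : ℤ) - r - 1) h =
      trace a b ((c : ℤ) - r) (toggle r c 0 h) + trace a b ((c : ℤ) - r) h := by
  have hg := toggle_mem H hh
  have e1 : trace a b ((c : ℤ) - r) (toggle r c 0 h) =
      ∑ s ∈ Finset.range (a + 1), toggle r c 0 h (r + s, c + s) := by
    refine sum_diagonal_eq _ (fun x y h => (hg.1 x y h).1) _ (fun s => (r + s, c + s))
      (fun s t hst => by simpa using hst) _ ?_
    rintro ⟨x, y⟩ h0
    have h1 := hg.1 x y h0
    have h2 := H.lt_of_not_mem h1.2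
    simp only [Prod.mk.injEq]
    exact ⟨fun h => ⟨x - r, by omega, by omega, by omega⟩, by rintro ⟨s, -, rfl, rfl⟩; omega⟩
  have e2 : trace a b ((c : ℤ) - r) h = ∑ s ∈ Finset.range (a + 1), h (r + s, c + s) := by
    refine sum_diagonal_eq _ (fun x y h => (hh.1 x y h).1) _ (fun s => (r + s, c + s))
      (fun s t hst => by simpa using hst) _ ?_
    rintro ⟨x, y⟩ h0
    have h1 := hh.1 x y h0
    have h2 := H.le_of_not_mem h1.2
    simp only [Prod.mk.injEq]
    exact ⟨fun h => ⟨x - r, by omega, by omega, by omega⟩, by rintro ⟨s, -, rfl, rfl⟩; omega⟩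
  have e3 : trace a b ((c : ℤ) - r + 1) h = ∑ s ∈ Finset.range a, h (r + s, c + s + 1) := by
    refine sum_diagonal_eq _ (fun x y h => (hh.1 x y h).1) _ (fun s => (r + s, c + s + 1))
      (fun s t hst => by simpa using hst) _ ?_
    rintro ⟨x, y⟩ h0
    have h1 := hh.1 x y h0
    have h2 := H.le_of_not_mem h1.2
    simp only [Prod.mk.injEq]
    exact ⟨fun h => ⟨x - r, by omega, by omega, by omega⟩, by rintro ⟨s, -, rfl, rfl⟩; omega⟩
  have e4 : trace a b ((c : ℤ) - r - 1) h = ∑ s ∈ Finset.range a, h (r + s + 1, c + s) := by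
    refine sum_diagonal_eq _ (fun x y h => (hh.1 x y h).1) _ (fun s => (r + s + 1, c + s))
      (fun s t hst => by simpa using hst) _ ?_
    rintro ⟨x, y⟩ h0
    have h1 := hh.1 x y h0
    have h2 := H.le_of_not_mem h1.2
    simp only [Prod.mk.injEq]
    exact ⟨fun h => ⟨x - r - 1, by omega, by omega, by omega⟩,
      by rintro ⟨s, -, rfl, rfl⟩; omega⟩
  -- After `a` steps the diagonal has left the rectangle, so the boundary maximum is zero.
  have key := sum_toggle_diag H hh a
  have z1 : h (r + a + 1, c + a) = 0 := by
    by_contra h0; have := (hh.1 _ _ h0).1; omega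
  have z2 : h (r + a, c + a + 1) = 0 := by
    by_contra h0; have := (hh.1 _ _ h0).1; omega
  rw [z1, z2, Finset.sum_add_distrib, Finset.sum_add_distrib] at key
  rw [e1, e2, e3, e4]
  omega

theorem sum_mul_indicator (u : ℤ) (h : ℕ × ℕ → ℕ) (k : ℤ) :
    ∑ z ∈ Finset.range a ×ˢ Finset.range b, (h z : ℤ) * (if (z.2 : ℤ) - z.1 = u then k else 0) =
      trace a b u h * k := by
  simp only [trace, mul_ite, mul_zero]
  rw [← Finset.sum_filter, ← Finset.sum_mul, Nat.cast_sum]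

/-- Let t = c - r and k = W(t+1) - W(t). Swapping the values of `W` at t and t + 1 changes the
content weights by k at t ± 1 and by -2k at t. By `trace_toggle` the toggle compensates exactly
this, up to the peak at the corner. -/
theorem contentWeight_toggle (H : IsAddBox α β r c) {h : ℕ × ℕ → ℕ} (hh : h ∈ skewPP a b α)
    (W : ℤ → ℤ) :
    contentWeight a b W h =
      peak r c h * (W ((c : ℤ) - r + 1) - W ((c : ℤ) - r)) +
        contentWeight a b (fun u => W (Equiv.swap ((c : ℤ) - r) ((c : ℤ) - r + 1) u))
          (toggle r c 0 h) := by
  set t : ℤ := (c : ℤ) - r with ht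
  set g := toggle r c 0 h with hg
  set k := W (t + 1) - W t with hk
  have h1 : ∀ u : ℤ, W (Equiv.swap t (t + 1) (u + 1)) - W (Equiv.swap t (t + 1) u) =
      (W (u + 1) - W u) + (if u = t + 1 then k else 0) + (if u = t - 1 then k else 0) -
        2 * (if u = t then k else 0) := by
    intro u
    rcases eq_or_ne u t with rfl | h1
    · rw [Equiv.swap_apply_left, Equiv.swap_apply_right, if_neg (by omega), if_neg (by omega),
        if_pos rfl]
      ring
    rcases eq_or_ne u (t + 1) with rfl | h2
    · rw [Equiv.swap_apply_right, Equiv.swap_apply_of_ne_of_ne (by omega) (by omega), if_pos rfl,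
        if_neg (by omega), if_neg (by omega)]
      ring
    rcases eq_or_ne u (t - 1) with rfl | h3
    · rw [sub_add_cancel, Equiv.swap_apply_left, Equiv.swap_apply_of_ne_of_ne (by omega) (by omega),
        if_pos rfl, if_neg (by omega), if_neg (by omega)]
      ring
    · rw [Equiv.swap_apply_of_ne_of_ne (by omega) (by omega),
        Equiv.swap_apply_of_ne_of_ne (by omega) (by omega), if_neg (by omega),
        if_neg (by omega), if_neg (by omega)]
      ring
  have h2 : contentWeight a b (fun u => W (Equiv.swap t (t + 1) u)) g = contentWeight a b W g +
      trace a b (t + 1) g * k + trace a b (t - 1) g * k - 2 * (trace a b t g * k) := by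
    simp only [contentWeight, h1]
    rw [← sum_mul_indicator, ← sum_mul_indicator, ← sum_mul_indicator, Finset.mul_sum,
      ← Finset.sum_add_distrib, ← Finset.sum_add_distrib, ← Finset.sum_sub_distrib]
    refine Finset.sum_congr rfl fun z _ => ?_
    ring
  have h3 : contentWeight a b W g - contentWeight a b W h =
      trace a b t g * k - trace a b t h * k := by
    rw [← sum_mul_indicator, ← sum_mul_indicator, contentWeight, contentWeight,
      ← Finset.sum_sub_distrib, ← Finset.sum_sub_distrib]
    refine Finset.sum_congr rfl fun z _ => ?_
    split_ifs with hz
    · rw [hz]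
    · rw [hg, toggle_off (x := z.1) (y := z.2) 0 h (by omega)]
      simp
  have h4 := trace_toggle H hh
  rw [h2, hg, trace_toggle_off (by omega), trace_toggle_off (by omega), ← hg]
  rw [← hg, ← ht] at h4
  have h5 : (peak r c h : ℤ) + trace a b (t + 1) h + trace a b (t - 1) h =
    trace a b t g + trace a b t h := by exact_mod_cast h4
  linear_combination (-1 : ℤ) * h3 - k * h5

end Toggle

/-! ### The hook bijection -/

section Hook

variable {a b : ℕ} {α β : YoungDiagram} {r c : ℕ}

theorem IsAddBox.rowLen_eq (H : IsAddBox α β r c) : α.rowLen r = c := by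
  have h1 : ¬ c < α.rowLen r := fun h => H.1 (YoungDiagram.mem_iff_lt_rowLen.2 h)
  by_contra h2
  have h3 : (r, α.rowLen r) ∈ β :=
    β.up_left_mem le_rfl (show α.rowLen r ≤ c by omega) ((H.2 _).2 (Or.inr rfl))
  rcases (H.2 _).1 h3 with h | h
  · exact lt_irrefl _ (YoungDiagram.mem_iff_lt_rowLen.1 h)
  · simp at h; omega

theorem IsAddBox.colLen_eq (H : IsAddBox α β r c) : α.colLen c = r := by
  have h1 : ¬ r < α.colLen c := fun h => H.1 (YoungDiagram.mem_iff_lt_colLen.2 h)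
  by_contra h2
  have h3 : (α.colLen c, c) ∈ β :=
    β.up_left_mem (show α.colLen c ≤ r by omega) le_rfl ((H.2 _).2 (Or.inr rfl))
  rcases (H.2 _).1 h3 with h | h
  · exact lt_irrefl _ (YoungDiagram.mem_iff_lt_colLen.1 h)
  · simp at h; omega

theorem IsAddBox.rowLen_right (H : IsAddBox α β r c) (x : ℕ) :
    β.rowLen x = if x = r then c + 1 else α.rowLen x := by
  refine eq_of_forall_lt_iff fun y => ?_
  rw [← YoungDiagram.mem_iff_lt_rowLen, H.2]
  split_ifs with h
  · subst h
    rw [YoungDiagram.mem_iff_lt_rowLen, H.rowLen_eq]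
    simp only [Prod.mk.injEq, true_and]
    omega
  · rw [YoungDiagram.mem_iff_lt_rowLen]
    simp [h]

theorem IsAddBox.colLen_right (H : IsAddBox α β r c) (y : ℕ) :
    β.colLen y = if y = c then r + 1 else α.colLen y := by
  refine eq_of_forall_lt_iff fun x => ?_
  rw [← YoungDiagram.mem_iff_lt_colLen, H.2]
  split_ifs with h
  · subst h
    rw [YoungDiagram.mem_iff_lt_colLen, H.colLen_eq]
    simp only [Prod.mk.injEq, and_true]
    omega
  · rw [YoungDiagram.mem_iff_lt_colLen]
    simp [h]

/-- The boundary of a diagram is encoded by row labels `rowLen x - x` and column labels `y - colLen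
y + 1`. Adding the box `(r, c)` exchanges the labels c - r and c - r + 1 between row r and column c,
and no other row carries either of them. -/
theorem IsAddBox.swap_row (H : IsAddBox α β r c) (x : ℕ) :
    Equiv.swap ((c : ℤ) - r) ((c : ℤ) - r + 1) ((β.rowLen x : ℤ) - x) = (α.rowLen x : ℤ) - x := by
  rw [H.rowLen_right]
  split_ifs with h
  · subst h
    rw [H.rowLen_eq]
    push_cast
    rw [show (c : ℤ) + 1 - x = c - x + 1 by ring, Equiv.swap_apply_right]
  · have h0 := H.rowLen_eq
    rcases lt_or_gt_of_ne h with h1 | h1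
    · have h2 : c < α.rowLen x := by
        rw [← YoungDiagram.mem_iff_lt_rowLen]
        rcases (H.2 _).1 (β.up_left_mem h1.le le_rfl ((H.2 (r, c)).2 (Or.inr rfl))) with h3 | h3
        · exact h3
        · simp at h3; omega
      exact Equiv.swap_apply_of_ne_of_ne (by omega) (by omega)
    · have h2 := α.rowLen_anti _ _ h1.le
      exact Equiv.swap_apply_of_ne_of_ne (by omega) (by omega)

theorem IsAddBox.swap_col (H : IsAddBox α β r c) (y : ℕ) :
    Equiv.swap ((c : ℤ) - r) ((c : ℤ) - r + 1) ((y : ℤ) - β.colLen y + 1) =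
      (y : ℤ) - α.colLen y + 1 := by
  rw [H.colLen_right]
  split_ifs with h
  · subst h
    rw [H.colLen_eq]
    push_cast
    rw [show (y : ℤ) - (r + 1) + 1 = y - r by ring, Equiv.swap_apply_left]
  · have h0 := H.colLen_eq
    rcases lt_or_gt_of_ne h with h1 | h1
    · have h2 : r < α.colLen y := by
        rw [← YoungDiagram.mem_iff_lt_colLen]
        rcases (H.2 _).1 (β.up_left_mem le_rfl h1.le ((H.2 (r, c)).2 (Or.inr rfl))) with h3 | h3
        · exact h3
        · simp at h3; omega
      exact Equiv.swap_apply_of_ne_of_ne (by omega) (by omega)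
    · have h2 := α.colLen_anti _ _ h1.le
      exact Equiv.swap_apply_of_ne_of_ne (by omega) (by omega)

/-- The weight of the hook of the box `z` in the complement of `α`, when a box of content `u` has
weight `W (u + 1) - W u`. -/
def hookWeight (α : YoungDiagram) (W : ℤ → ℤ) (z : ℕ × ℕ) : ℤ :=
  W ((z.2 : ℤ) - α.colLen z.2 + 1) - W ((α.rowLen z.1 : ℤ) - z.1)

theorem IsAddBox.hookWeight_right (H : IsAddBox α β r c) (W : ℤ → ℤ) (z : ℕ × ℕ) :
    hookWeight β (fun u => W (Equiv.swap ((c : ℤ) - r) ((c : ℤ) - r + 1) u)) z =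
      hookWeight α W z := by
  simp only [hookWeight, H.swap_row, H.swap_col]

/-- A box outside `α` with minimal coordinate sum has every smaller box in `α`, so it can be added.
-/
theorem exists_isAddBox {x y : ℕ} (hx : x < a) (hy : y < b) (hxy : (x, y) ∉ α) :
    ∃ β r c, IsAddBox α β r c ∧ r < a ∧ c < b := by
  classical
  obtain ⟨⟨r, c⟩, hz, hmin⟩ := Finset.exists_min_image
    ((Finset.range a ×ˢ Finset.range b) \ α.cells) (fun z => z.1 + z.2)
    ⟨(x, y), by simp [hx, hy, hxy]⟩
  simp only [Finset.mem_sdiff, Finset.mem_product, Finset.mem_range, YoungDiagram.mem_cells,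
    Prod.forall] at hz hmin
  refine ⟨⟨insert (r, c) α.cells, ?_⟩, r, c, ⟨hz.2, fun z => ?_⟩, hz.1⟩
  · rintro ⟨x, y⟩ ⟨x', y'⟩ hle hmem
    obtain ⟨hle1, hle2⟩ : x' ≤ x ∧ y' ≤ y := hle
    simp only [Finset.coe_insert, Set.mem_insert_iff, Prod.mk.injEq, Finset.mem_coe,
      YoungDiagram.mem_cells] at hmem ⊢
    rcases hmem with ⟨rfl, rfl⟩ | h
    · by_cases h : (x', y') ∈ α
      · exact Or.inr h
      · have := hmin x' y' ⟨⟨by omega, by omega⟩, h⟩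
        left; omega
    · exact Or.inr (α.up_left_mem hle1 hle2 h)
  · rw [← YoungDiagram.mem_cells]
    simp [or_comm]

/-- Induction on the number of boxes of the rectangle outside `α`: a corner is toggled into the
diagram and its peak becomes the new entry there. The weight `W` must be arbitrary because each
toggle permutes its values; `hookWeight` is invariant under that permutation. -/
theorem exists_bijOn_hook (a b : ℕ) (α : YoungDiagram) :
    ∃ e : (ℕ × ℕ → ℕ) → (ℕ × ℕ → ℕ), Set.BijOn e (skewPP a b α) (skewFun a b α) ∧
      ∀ h ∈ skewPP a b α, ∀ W : ℤ → ℤ, contentWeight a b W h =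
        ∑ z ∈ Finset.range a ×ˢ Finset.range b, (e h z : ℤ) * hookWeight α W z := by
  classical
  induction hn : ((Finset.range a ×ˢ Finset.range b) \ α.cells).card generalizing α with
  | zero =>
    have hα : ∀ x y, x < a ∧ y < b → (x, y) ∈ α := by
      intro x y hxy
      by_contra hc
      have h1 := Finset.card_eq_zero.1 hn
      have : (x, y) ∈ ((Finset.range a ×ˢ Finset.range b) \ α.cells) := by simp [hxy, hc]
      rw [h1] at this
      simp at this
    have h1 : skewPP a b α = {0} := by
      ext h
      rw [Set.mem_singleton_iff]
      constructor
      · intro hh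
        funext ⟨x, y⟩
        by_contra h0
        exact (hh.1 x y h0).2 (hα x y (hh.1 x y h0).1)
      · rintro rfl
        exact ⟨fun x y h => absurd rfl h, fun x y _ => ⟨le_rfl, le_rfl⟩⟩
    have h2 : skewFun a b α = {0} := by
      ext h
      rw [Set.mem_singleton_iff]
      constructor
      · intro hh
        funext ⟨x, y⟩
        by_contra h0
        exact (hh x y h0).2 (hα x y (hh x y h0).1)
      · rintro rfl
        exact fun x y h => absurd rfl h
    refine ⟨id, ?_, ?_⟩
    · rw [h1, h2]; exact Set.bijOn_id _
    · rw [h1]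
      rintro h rfl W
      simp [contentWeight]
  | succ n ih =>
    obtain ⟨⟨x, y⟩, hz⟩ : ((Finset.range a ×ˢ Finset.range b) \ α.cells).Nonempty := by
      rw [← Finset.card_pos]; omega
    simp only [Finset.mem_sdiff, Finset.mem_product, Finset.mem_range,
      YoungDiagram.mem_cells] at hz
    obtain ⟨β, r, c, H, hr, hc⟩ := exists_isAddBox hz.1.1 hz.1.2 hz.2
    have hrc : (r, c) ∈ (Finset.range a ×ˢ Finset.range b) \ α.cells := by simp [hr, hc, H.1]
    have hcard : ((Finset.range a ×ˢ Finset.range b) \ β.cells).card = n := by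
      have : (Finset.range a ×ˢ Finset.range b) \ β.cells =
          ((Finset.range a ×ˢ Finset.range b) \ α.cells).erase (r, c) := by
        ext z
        simp only [Finset.mem_sdiff, YoungDiagram.mem_cells, H.2, Finset.mem_erase]
        tauto
      rw [this, Finset.card_erase_of_mem hrc, hn]
      rfl
    obtain ⟨e, he, hw⟩ := ih β hcard
    -- The array attached to `β` vanishes at the corner, so this cell is free to record the peak.
    have e0 : ∀ g ∈ skewPP a b β, e g (r, c) = 0 := by
      intro g hg
      by_contra h0
      exact (he.mapsTo hg r c h0).2 ((H.2 _).2 (Or.inr rfl))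
    have hpeak : ∀ h ∈ skewPP a b α, toggle r c (peak r c h + max (toggle r c 0 h (r + 1, c))
        (toggle r c 0 h (r, c + 1))) (toggle r c 0 h) = h := by
      intro h hh
      apply toggle_toggle H 0 _ (skewPP_antitone_off H hh)
      rw [toggle_off 0 h (by omega), toggle_off 0 h (by omega), peak]
      have := hh.2 r c H.1
      omega
    refine ⟨fun h => Function.update (e (toggle r c 0 h)) (r, c) (peak r c h), ⟨?_, ?_, ?_⟩, ?_⟩
    · intro h hh x y h0
      by_cases hxy : (x, y) = (r, c)
      · simp only [Prod.mk.injEq] at hxy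
        obtain ⟨rfl, rfl⟩ := hxy
        exact ⟨⟨hr, hc⟩, H.1⟩
      · simp only [Function.update_of_ne hxy] at h0
        have := he.mapsTo (toggle_mem H hh) x y h0
        exact ⟨this.1, H.not_mem_right this.2⟩
    · intro h hh h' hh' heq
      have h1 : peak r c h = peak r c h' := by
        have := congrFun heq (r, c)
        simpa using this
      have h2 : toggle r c 0 h = toggle r c 0 h' := by
        apply he.injOn (toggle_mem H hh) (toggle_mem H hh')
        funext z
        by_cases hz : z = (r, c)
        · rw [hz, e0 _ (toggle_mem H hh), e0 _ (toggle_mem H hh')]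
        · have := congrFun heq z
          simpa [Function.update_of_ne hz] using this
      rw [← hpeak h hh, ← hpeak h' hh', h1, h2]
    · intro f hf
      have hf' : Function.update f (r, c) 0 ∈ skewFun a b β := by
        intro x y h0
        by_cases hxy : (x, y) = (r, c)
        · rw [hxy] at h0; simp at h0
        · rw [Function.update_of_ne hxy] at h0
          have := hf x y h0
          exact ⟨this.1, fun hb => ((H.2 _).1 hb).elim this.2 hxy⟩
      obtain ⟨g, hg, hgf⟩ := he.surjOn hf'
      set m := max (g (r + 1, c)) (g (r, c + 1)) with hm
      refine ⟨toggle r c (f (r, c) + m) g, untoggle_mem H hr hc hg _, ?_⟩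
      have g0 : g (r, c) = 0 := by
        by_contra h0
        exact (hg.1 r c h0).2 ((H.2 _).2 (Or.inr rfl))
      have h1 : toggle r c 0 (toggle r c (f (r, c) + m) g) = g := toggle_toggle H _ _ hg.2 g0
      have h2 : peak r c (toggle r c (f (r, c) + m) g) = f (r, c) := by
        rw [peak, toggle_corner, toggle_off _ g (by omega), toggle_off _ g (by omega)]
        omega
      simp only [h1, h2, hgf]
      simp
    · intro h hh W
      rw [contentWeight_toggle H hh, hw _ (toggle_mem H hh)]
      simp only [H.hookWeight_right]
      have hmem : (r, c) ∈ Finset.range a ×ˢ Finset.range b := by simp [hr, hc]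
      rw [← Finset.add_sum_erase _ _ hmem, ← Finset.add_sum_erase _ _ hmem, e0 _ (toggle_mem H hh)]
      simp only [Function.update_self, Nat.cast_zero, zero_mul, zero_add]
      congr 1
      · rw [hookWeight, H.rowLen_eq]
        simp only
        rw [H.colLen_eq]
      · refine Finset.sum_congr rfl fun z hz => ?_
        rw [Function.update_of_ne (Finset.ne_of_mem_erase hz)]

/-- The total of `h` over the `a × b` rectangle. -/
def total (a b : ℕ) (h : ℕ × ℕ → ℕ) : ℕ := ∑ z ∈ Finset.range a ×ˢ Finset.range b, h z

/-- The hook length of the box `z` in the complement of `α`. -/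
def hookLen (α : YoungDiagram) (z : ℕ × ℕ) : ℕ :=
  z.1 + z.2 + 1 - (α.rowLen z.1 + α.colLen z.2)

/-- Ensures that the subtraction in `hookLen` is not truncated and that hook lengths outside `α` are
positive. -/
theorem hookLen_spec {x y : ℕ} (hxy : (x, y) ∉ α) :
    α.rowLen x ≤ y ∧ α.colLen y ≤ x := by
  constructor
  · by_contra h; exact hxy (YoungDiagram.mem_iff_lt_rowLen.2 (by omega))
  · by_contra h; exact hxy (YoungDiagram.mem_iff_lt_colLen.2 (by omega))

/-- The hook bijection for skew plane partitions in a rectangle. -/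
theorem exists_bijOn_total (a b : ℕ) (α : YoungDiagram) :
    ∃ e : (ℕ × ℕ → ℕ) → (ℕ × ℕ → ℕ), Set.BijOn e (skewPP a b α) (skewFun a b α) ∧
      ∀ h ∈ skewPP a b α, total a b h =
        ∑ z ∈ Finset.range a ×ˢ Finset.range b, e h z * hookLen α z := by
  obtain ⟨e, he, hw⟩ := exists_bijOn_hook a b α
  refine ⟨e, he, fun h hh => ?_⟩
  have h1 := hw h hh id
  simp only [contentWeight, id, add_sub_cancel_left, mul_one] at h1
  zify
  rw [total, Nat.cast_sum, h1]
  refine Finset.sum_congr rfl fun z hz => ?_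
  by_cases h0 : e h z = 0
  · simp [h0]
  · have := hookLen_spec (he.mapsTo hh z.1 z.2 h0).2
    rw [hookWeight, hookLen, Nat.cast_sub (by omega)]
    simp only [id]
    push_cast
    ring

end Hook

/-! ### Generating functions of weighted arrays -/

/-- The generating function of the functions supported on `D`, where a unit at `z` has size `k z`. -/
noncomputable def funGF (D : Finset (ℕ × ℕ)) (k : ℕ × ℕ → ℕ) : PowerSeries ℚ :=
  PowerSeries.mk fun n =>
    ({g : ℕ × ℕ → ℕ | (∀ z, g z ≠ 0 → z ∈ D) ∧ ∑ z ∈ D, g z * k z = n}.ncard : ℚ)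

theorem finite_funs (D : Finset (ℕ × ℕ)) (k : ℕ × ℕ → ℕ) (hk : ∀ z ∈ D, 0 < k z) (n : ℕ) :
    {g : ℕ × ℕ → ℕ | (∀ z, g z ≠ 0 → z ∈ D) ∧ ∑ z ∈ D, g z * k z = n}.Finite := by
  classical
  refine Set.Finite.of_finite_image (f := fun g => fun z : D => g z)
    ((Set.Finite.pi (fun _ : D => Set.finite_Iic n)).subset ?_) ?_
  · rintro _ ⟨g, hg, rfl⟩ z _
    have h1 : g z * k z ≤ n := by
      rw [← hg.2]
      exact Finset.single_le_sum (f := fun z => g z * k z) (fun _ _ => Nat.zero_le _) z.2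
    exact (Nat.le_mul_of_pos_right _ (hk z z.2)).trans h1
  · intro g hg g' hg' h
    funext z
    by_cases hz : z ∈ D
    · exact congrFun h ⟨z, hz⟩
    · rw [not_not.1 (mt (hg.1 z) hz), not_not.1 (mt (hg'.1 z) hz)]

/-- Lowering `g c` by one matches the arrays with `g c ≠ 0` with all arrays of size smaller by `k
c`; what remains are the arrays on `D`. -/
theorem funGF_insert (D : Finset (ℕ × ℕ)) (k : ℕ × ℕ → ℕ) (c : ℕ × ℕ) (hc : c ∉ D)
    (hk : ∀ z ∈ insert c D, 0 < k z) :
    funGF D k = funGF (insert c D) k * (1 - PowerSeries.X ^ k c) := by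
  classical
  ext n
  rw [mul_sub, mul_one, map_sub, PowerSeries.coeff_mul_X_pow', eq_sub_iff_add_eq]
  simp only [funGF, PowerSeries.coeff_mk]
  set A : ℕ → Set (ℕ × ℕ → ℕ) := fun n =>
    {g | (∀ z, g z ≠ 0 → z ∈ insert c D) ∧ ∑ z ∈ insert c D, g z * k z = n} with hA
  have hfin : ∀ n, (A n).Finite := fun n => finite_funs _ k hk n
  have h1 : {g : ℕ × ℕ → ℕ | (∀ z, g z ≠ 0 → z ∈ D) ∧ ∑ z ∈ D, g z * k z = n} =
      A n \ {g | g c ≠ 0} := by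
    ext g
    simp only [hA, Finset.sum_insert hc, Set.mem_sdiff, Set.mem_ofPred_eq, not_not,
      Finset.mem_insert]
    constructor
    · rintro ⟨h1, h2⟩
      have h0 : g c = 0 := not_not.1 (mt (h1 c) hc)
      exact ⟨⟨fun z hz => Or.inr (h1 z hz), by rw [h0, zero_mul, zero_add, h2]⟩, h0⟩
    · rintro ⟨⟨h1, h2⟩, h0⟩
      refine ⟨fun z hz => (h1 z hz).resolve_left ?_, by rwa [h0, zero_mul, zero_add] at h2⟩
      rintro rfl
      exact hz h0
  have h2 : (A n ∩ {g | g c ≠ 0}).ncard = if k c ≤ n then (A (n - k c)).ncard else 0 := by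
    split_ifs with hn
    · rw [← Set.InjOn.ncard_image (s := A (n - k c))
        (f := fun g => Function.update g c (g c + 1))]
      · congr 1
        ext g
        simp only [Set.mem_inter_iff, Set.mem_ofPred_eq, Set.mem_image, hA]
        constructor
        · rintro ⟨⟨h1, h2⟩, h0⟩
          refine ⟨Function.update g c (g c - 1), ⟨fun z hz => ?_, ?_⟩, ?_⟩
          · by_cases hzc : z = c
            · rw [hzc]; exact Finset.mem_insert_self _ _
            · rw [Function.update_of_ne hzc] at hz
              exact h1 z hz
          · rw [Finset.sum_insert hc] at h2 ⊢
            rw [Function.update_self, Finset.sum_congr rfl (g := fun z => g z * k z) ?_]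
            · rw [tsub_mul, one_mul]
              have : k c ≤ g c * k c := Nat.le_mul_of_pos_left _ (Nat.pos_of_ne_zero h0)
              omega
            · intro z hz
              rw [Function.update_of_ne (by rintro rfl; exact hc hz)]
          · rw [Function.update_self, Function.update_idem, Nat.sub_add_cancel
              (Nat.pos_of_ne_zero h0), Function.update_eq_self]
        · rintro ⟨f, ⟨h1, h2⟩, rfl⟩
          refine ⟨⟨fun z hz => ?_, ?_⟩, by simp⟩
          · by_cases hzc : z = c
            · rw [hzc]; exact Finset.mem_insert_self _ _
            · rw [Function.update_of_ne hzc] at hz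
              exact h1 z hz
          · rw [Finset.sum_insert hc] at h2 ⊢
            rw [Function.update_self, Finset.sum_congr rfl (g := fun z => f z * k z) ?_]
            · rw [add_mul, one_mul]
              omega
            · intro z hz
              rw [Function.update_of_ne (by rintro rfl; exact hc hz)]
      · intro f _ g _ hfg
        funext z
        have := congrFun hfg z
        by_cases hz : z = c
        · subst hz; simpa using this
        · simpa [Function.update_of_ne hz] using this
    · rw [Set.ncard_eq_zero ((hfin n).subset Set.inter_subset_left)]
      ext g
      simp only [hA, Set.mem_inter_iff, Set.mem_ofPred_eq, Set.mem_empty_iff_false, iff_false,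
        not_and, not_not, Finset.sum_insert hc]
      rintro ⟨-, h2⟩
      by_contra h0
      have : k c ≤ g c * k c := Nat.le_mul_of_pos_left _ (Nat.pos_of_ne_zero h0)
      omega
  have h3 : ((A n).ncard : ℚ) = (A n ∩ {g | g c ≠ 0}).ncard + (A n \ {g | g c ≠ 0}).ncard := by
    exact_mod_cast (Set.ncard_inter_add_ncard_sdiff_eq_ncard _ _ (hfin n)).symm
  rw [h1, h3, h2, add_comm]
  split_ifs
  · rfl
  · simp

theorem funGF_union (D S : Finset (ℕ × ℕ)) (k : ℕ × ℕ → ℕ) (hDS : Disjoint D S)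
    (hk : ∀ z ∈ D ∪ S, 0 < k z) :
    funGF D k = funGF (D ∪ S) k * ∏ z ∈ S, (1 - PowerSeries.X ^ k z) := by
  classical
  induction S using Finset.induction_on with
  | empty => simp
  | insert c S hc ih =>
    rw [Finset.disjoint_insert_right] at hDS
    have h1 : c ∉ D ∪ S := by simp [hDS.1, hc]
    rw [Finset.union_insert] at hk ⊢
    rw [Finset.prod_insert hc, ih hDS.2 (fun z hz => hk z (Finset.mem_insert_of_mem hz)),
      funGF_insert _ k c h1 hk, mul_assoc]

/-! ### Counting skew plane partitions in a rectangle -/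

section GF

variable {a b : ℕ} {α : YoungDiagram}

/-- The number of skew plane partitions of total `m`. -/
noncomputable def countPP (a b : ℕ) (α : YoungDiagram) (m : ℤ) : ℕ :=
  {h | h ∈ skewPP a b α ∧ (total a b h : ℤ) = m}.ncard

theorem countPP_of_neg {m : ℤ} (hm : m < 0) : countPP a b α m = 0 := by
  have : {h | h ∈ skewPP a b α ∧ (total a b h : ℤ) = m} = ∅ := by
    ext h
    simp only [Set.mem_ofPred_eq, Set.mem_empty_iff_false, iff_false]
    omega
  rw [countPP, this, Set.ncard_empty]

theorem finite_skewPP (m : ℤ) : {h | h ∈ skewPP a b α ∧ (total a b h : ℤ) = m}.Finite := by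
  refine (finite_funs (Finset.range a ×ˢ Finset.range b) (fun _ => 1) (fun _ _ => one_pos)
    m.toNat).subset ?_
  rintro h ⟨h1, h2⟩
  refine ⟨fun z hz => ?_, ?_⟩
  · have := (h1.1 z.1 z.2 hz).1
    simp [this]
  · simp only [mul_one]
    change total a b h = m.toNat
    omega

/-- The generating function of skew plane partitions. -/
noncomputable def skewGF (a b : ℕ) (α : YoungDiagram) : PowerSeries ℚ :=
  PowerSeries.mk fun n => (countPP a b α n : ℚ)

theorem skewGF_eq_funGF (a b : ℕ) (α : YoungDiagram) :
    skewGF a b α = funGF ((Finset.range a ×ˢ Finset.range b) \ α.cells) (hookLen α) := by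
  classical
  ext n
  simp only [skewGF, funGF, PowerSeries.coeff_mk, Nat.cast_inj]
  obtain ⟨e, he, hw⟩ := exists_bijOn_total a b α
  rw [countPP, ← Set.InjOn.ncard_image (f := e) (he.injOn.mono fun h hh => hh.1)]
  congr 1
  have hsum : ∀ f ∈ skewFun a b α, ∑ z ∈ Finset.range a ×ˢ Finset.range b, f z * hookLen α z =
      ∑ z ∈ (Finset.range a ×ˢ Finset.range b) \ α.cells, f z * hookLen α z := by
    intro f hf
    symm
    refine Finset.sum_subset Finset.sdiff_subset fun z hz hz' => ?_
    have : f z = 0 := by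
      by_contra h0
      have := hf z.1 z.2 h0
      simp [this] at hz'
    rw [this, zero_mul]
  ext f
  simp only [Set.mem_image, Set.mem_ofPred_eq, Nat.cast_inj]
  constructor
  · rintro ⟨h, ⟨hh, ht⟩, rfl⟩
    have hm := he.mapsTo hh
    refine ⟨fun z hz => ?_, ?_⟩
    · have := hm z.1 z.2 hz
      simp [this]
    · rw [← hsum _ hm, ← hw h hh, ht]
  · rintro ⟨h1, h2⟩
    have hf : f ∈ skewFun a b α := by
      intro x y h0
      have := h1 _ h0
      simpa using this
    obtain ⟨h, hh, rfl⟩ := he.surjOn hf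
    exact ⟨h, ⟨hh, by rw [hw h hh, hsum _ hf, h2]⟩, rfl⟩

/-- Hook lengths depend on `α` alone, so widening the rectangle only adds the hooks of column `b`,
which misses `α`. -/
theorem skewGF_eq_succ (hb : α.rowLen 0 ≤ b) :
    skewGF a b α = skewGF a (b + 1) α *
      ∏ i ∈ Finset.range a, (1 - PowerSeries.X ^ (b + 1 + i - α.rowLen i)) := by
  classical
  have hcol : ∀ x, (x, b) ∉ α := by
    intro x h
    have := YoungDiagram.mem_iff_lt_rowLen.1 (α.up_left_mem (Nat.zero_le x) le_rfl h)
    omega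
  have hcol0 : α.colLen b = 0 := by
    by_contra h
    exact hcol 0 (YoungDiagram.mem_iff_lt_colLen.2 (by omega))
  set S : Finset (ℕ × ℕ) := (Finset.range a).image fun i => (i, b) with hS
  have hU : (Finset.range a ×ˢ Finset.range (b + 1)) \ α.cells =
      ((Finset.range a ×ˢ Finset.range b) \ α.cells) ∪ S := by
    ext ⟨x, y⟩
    have := hcol x
    simp only [hS, Finset.mem_sdiff, Finset.mem_product, Finset.mem_range, Finset.mem_union,
      Finset.mem_image, Prod.mk.injEq, YoungDiagram.mem_cells]
    constructor
    · rintro ⟨⟨h1, h2⟩, h3⟩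
      rcases Nat.lt_succ_iff_lt_or_eq.1 h2 with h2 | rfl
      · exact Or.inl ⟨⟨h1, h2⟩, h3⟩
      · exact Or.inr ⟨x, h1, rfl, rfl⟩
    · rintro (⟨⟨h1, h2⟩, h3⟩ | ⟨_, h1, rfl, rfl⟩)
      · exact ⟨⟨h1, by omega⟩, h3⟩
      · exact ⟨⟨h1, by omega⟩, this⟩
  have hdisj : Disjoint ((Finset.range a ×ˢ Finset.range b) \ α.cells) S := by
    rw [Finset.disjoint_right]
    intro z hz hz'
    obtain ⟨i, -, rfl⟩ := Finset.mem_image.1 hz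
    simp at hz'
  rw [skewGF_eq_funGF, skewGF_eq_funGF, hU, funGF_union _ S _ hdisj, hS, Finset.prod_image]
  · congr 1
    refine Finset.prod_congr rfl fun i _ => ?_
    rw [hookLen, hcol0]
    congr 2
    simp only
    omega
  · intro i _ j _ h
    simpa using h
  · rw [← hU]
    rintro ⟨x, y⟩ hz
    simp only [Finset.mem_sdiff, YoungDiagram.mem_cells] at hz
    have := hookLen_spec hz.2
    simp only [hookLen]
    omega

/-- Products of two or more of the `f i` are divisible by `y ^ 2`, so only the linear part has to be
kept. -/
theorem prod_one_sub_eq {R ι : Type*} [CommRing R] (s : Finset ι) (f : ι → R) (y : R)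
    (hf : ∀ i ∈ s, y ∣ f i) : ∃ u, ∏ i ∈ s, (1 - f i) = 1 - ∑ i ∈ s, f i + y ^ 2 * u := by
  classical
  induction s using Finset.induction_on with
  | empty => exact ⟨0, by simp⟩
  | insert i s hi ih =>
    obtain ⟨u, hu⟩ := ih fun j hj => hf j (Finset.mem_insert_of_mem hj)
    obtain ⟨v, hv⟩ := hf i (Finset.mem_insert_self _ _)
    obtain ⟨w, hw⟩ : y ∣ ∑ j ∈ s, f j :=
      Finset.dvd_sum fun j hj => hf j (Finset.mem_insert_of_mem hj)
    refine ⟨v * w + u - y * v * u, ?_⟩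
    rw [Finset.prod_insert hi, Finset.sum_insert hi, hu, hv, hw]
    ring

theorem skewPP_antitone {h : ℕ × ℕ → ℕ} (hh : h ∈ skewPP a b α) {x y x' y' : ℕ}
    (hxy : (x, y) ∉ α) (hx : x ≤ x') (hy : y ≤ y') : h (x', y') ≤ h (x, y) := by
  have h1 : h (x', y) ≤ h (x, y) := by
    induction x', hx using Nat.le_induction with
    | base => exact le_rfl
    | succ n hn ih => exact ((hh.2 n y (not_mem_of_le_of_not_mem hxy hn le_rfl)).1).trans ih
  refine le_trans ?_ h1
  induction y', hy using Nat.le_induction with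
  | base => exact le_rfl
  | succ n hn ih => exact ((hh.2 x' n (not_mem_of_le_of_not_mem hxy hx hn)).2).trans ih

/-- The entry at `(0, b)` dominates the last column, so it vanishes exactly when the array fits in
width `b`. -/
theorem countPP_succ (hb : α.rowLen 0 ≤ b) (m : ℤ) :
    countPP a (b + 1) α m =
      {h | (h ∈ skewPP a (b + 1) α ∧ (total a (b + 1) h : ℤ) = m) ∧ h (0, b) ≠ 0}.ncard +
        countPP a b α m := by
  have h0b : (0, b) ∉ α := fun h => by
    have := YoungDiagram.mem_iff_lt_rowLen.1 h
    omega
  rw [countPP, ← Set.ncard_inter_add_ncard_sdiff_eq_ncard _ {h : ℕ × ℕ → ℕ | h (0, b) ≠ 0}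
    (finite_skewPP m)]
  congr 1
  rw [countPP]
  congr 1
  have key : ∀ h : ℕ × ℕ → ℕ, (∀ x, h (x, b) = 0) → total a (b + 1) h = total a b h := by
    intro h hx
    rw [total, total, Finset.sum_product, Finset.sum_product]
    refine Finset.sum_congr rfl fun x _ => ?_
    rw [Finset.sum_range_succ, hx, add_zero]
  ext h
  simp only [Set.mem_sdiff, Set.mem_ofPred_eq, not_not]
  constructor
  · rintro ⟨⟨h1, h2⟩, h3⟩
    have hx : ∀ x, h (x, b) = 0 := fun x => by
      have := skewPP_antitone h1 h0b (Nat.zero_le x) le_rfl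
      omega
    refine ⟨⟨fun x y hxy => ?_, h1.2⟩, by rw [← key h hx, h2]⟩
    have := h1.1 x y hxy
    refine ⟨⟨this.1.1, ?_⟩, this.2⟩
    by_contra hc
    have hy : y = b := by omega
    exact hxy (hy ▸ hx x)
  · rintro ⟨h1, h2⟩
    have hx : ∀ x, h (x, b) = 0 := fun x => by
      by_contra hc
      have := h1.1 _ _ hc
      omega
    refine ⟨⟨⟨fun x y hxy => ?_, h1.2⟩, by rw [key h hx, h2]⟩, hx 0⟩
    have := h1.1 x y hxy
    exact ⟨⟨this.1.1, by omega⟩, this.2⟩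

/-- These arrays are counted by the difference for widths b + 1 and b, that is by `skewGF a (b + 1)
α` times one minus the product of `skewGF_eq_succ`. In this degree only the linear terms of the
product survive. -/
theorem ncard_skewPP_ne_zero (hb : α.rowLen 0 ≤ b) (n : ℤ) (hn : n + 2 * α.rowLen 0 < b + 1)
    (hn0 : 0 ≤ n + b + 1) :
    {h | (h ∈ skewPP a (b + 1) α ∧ (total a (b + 1) h : ℤ) = n + b + 1) ∧ h (0, b) ≠ 0}.ncard =
      ∑ i ∈ Finset.range a, countPP a (b + 1) α (n + α.rowLen i - i) := by
  have hrow : ∀ i, α.rowLen i ≤ α.rowLen 0 := fun i => α.rowLen_anti _ _ (Nat.zero_le i)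
  obtain ⟨N, hN⟩ := Int.eq_ofNat_of_zero_le hn0
  have h1 := countPP_succ (a := a) hb (n + b + 1)
  have h2 := congrArg (PowerSeries.coeff N) (skewGF_eq_succ (a := a) hb)
  -- The exponents are at least b + 1 - λ_0, and twice this bound exceeds N = n + b + 1 by `hn`.
  obtain ⟨u, hu⟩ := prod_one_sub_eq (Finset.range a)
    (fun i => (PowerSeries.X : PowerSeries ℚ) ^ (b + 1 + i - α.rowLen i))
    (PowerSeries.X ^ (b + 1 - α.rowLen 0))
    (fun i _ => pow_dvd_pow _ (by have := hrow i; omega))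
  have h3 : PowerSeries.coeff N (skewGF a (b + 1) α *
      ((PowerSeries.X ^ (b + 1 - α.rowLen 0)) ^ 2 * u)) = 0 := by
    rw [← pow_mul, mul_left_comm, PowerSeries.coeff_X_pow_mul', if_neg (by omega)]
  rw [hu, mul_add, map_add, h3, add_zero, mul_sub, mul_one, map_sub, Finset.mul_sum, map_sum] at h2
  have h4 : ∀ i ∈ Finset.range a, PowerSeries.coeff N (skewGF a (b + 1) α *
      PowerSeries.X ^ (b + 1 + i - α.rowLen i)) =
        (countPP a (b + 1) α (n + α.rowLen i - i) : ℚ) := by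
    intro i _
    have := hrow i
    rw [PowerSeries.coeff_mul_X_pow']
    split_ifs with h
    · rw [skewGF, PowerSeries.coeff_mk]
      congr 2
      omega
    · rw [countPP_of_neg (by omega), Nat.cast_zero]
  rw [Finset.sum_congr rfl h4] at h2
  simp only [skewGF, PowerSeries.coeff_mk] at h2
  rw [hN] at h1
  rw [hN]
  have h5 : (countPP a (b + 1) α N : ℚ) = _ := congrArg Nat.cast h1
  rw [← Nat.cast_inj (R := ℚ)]
  push_cast at h5 ⊢
  linarith

end GF

/-! ### 3D partitions as stacks over skew plane partitions -/

section Boxes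

variable {a b : ℕ} {α μ : YoungDiagram}

/-- The boxes stacked with heights `h`, the legs with cross-sections `∅`, `μ`, `α`, and everything
above `α`. -/
def stack (μ α : YoungDiagram) (h : ℕ × ℕ → ℕ) : Set (ℕ × ℕ × ℕ) :=
  {t | t.2.2 < h (t.1, t.2.1)} ∪ legs ⊥ μ α

theorem mem_legs {i j k : ℕ} : (i, j, k) ∈ legs ⊥ μ α ↔ (k, i) ∈ μ ∨ (i, j) ∈ α := by
  simp [legs, leg₁, leg₂, leg₃, YoungDiagram.notMem_bot]

theorem mem_stack {h : ℕ × ℕ → ℕ} {i j k : ℕ} :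
    (i, j, k) ∈ stack μ α h ↔ k < h (i, j) ∨ (k, i) ∈ μ ∨ (i, j) ∈ α := by
  rw [stack, Set.mem_union, mem_legs]
  rfl

theorem mem_oneBox {z : ℕ × ℕ} : z ∈ oneBox ↔ z = (0, 0) := by
  rw [← YoungDiagram.mem_cells]
  simp [oneBox]

theorem boxes_eq_coe {h : ℕ × ℕ → ℕ} (hh : h ∈ skewPP a b α) :
    {t : ℕ × ℕ × ℕ | t.2.2 < h (t.1, t.2.1)} =
      (((Finset.range a ×ˢ Finset.range b).sigma fun z => Finset.range (h z)).map
        ⟨fun s : (_ : ℕ × ℕ) × ℕ => ((s.1.1, s.1.2, s.2) : ℕ × ℕ × ℕ), by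
          rintro ⟨⟨x, y⟩, k⟩ ⟨⟨x', y'⟩, k'⟩ h
          simp only [Prod.mk.injEq] at h
          obtain ⟨rfl, rfl, rfl⟩ := h
          rfl⟩ : Finset (ℕ × ℕ × ℕ)) := by
  ext ⟨i, j, k⟩
  simp only [Set.mem_ofPred_eq, Finset.coe_map, Set.mem_image,
    Finset.mem_coe, Finset.mem_sigma, Finset.mem_product, Finset.mem_range,
    Sigma.exists, Prod.exists]
  constructor
  · intro hk
    exact ⟨i, j, k, ⟨(hh.1 i j (by omega)).1, hk⟩, rfl⟩
  · rintro ⟨i', j', k', ⟨-, hk⟩, heq⟩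
    have heq' : ((i', j', k') : ℕ × ℕ × ℕ) = (i, j, k) := heq
    simp only [Prod.mk.injEq] at heq'
    obtain ⟨rfl, rfl, rfl⟩ := heq'
    exact hk

theorem finite_boxes {h : ℕ × ℕ → ℕ} (hh : h ∈ skewPP a b α) :
    {t : ℕ × ℕ × ℕ | t.2.2 < h (t.1, t.2.1)}.Finite := by
  rw [boxes_eq_coe hh]
  exact Finset.finite_toSet _

theorem ncard_boxes {h : ℕ × ℕ → ℕ} (hh : h ∈ skewPP a b α) :
    {t : ℕ × ℕ × ℕ | t.2.2 < h (t.1, t.2.1)}.ncard = total a b h := by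
  rw [boxes_eq_coe hh, Set.ncard_coe_finset, Finset.card_map, Finset.card_sigma, total]
  simp

theorem isThreeDPartition_stack {h : ℕ × ℕ → ℕ} (hh : h ∈ skewPP a b α) :
    IsThreeDPartition ⊥ μ α (stack μ α h) := by
  refine ⟨?_, Set.subset_union_right, ?_⟩
  · rintro ⟨i, j, k⟩ ⟨i', j', k'⟩ hle ht
    obtain ⟨hi, hj, hk⟩ : i' ≤ i ∧ j' ≤ j ∧ k' ≤ k := hle
    rw [mem_stack] at ht ⊢
    by_cases hα : (i', j') ∈ α
    · exact Or.inr (Or.inr hα)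
    · rcases ht with ht | ht | ht
      · exact Or.inl ((hk.trans_lt ht).trans_le (skewPP_antitone hh hα hi hj))
      · exact Or.inr (Or.inl (μ.up_left_mem hk hi ht))
      · exact absurd (α.up_left_mem hi hj ht) hα
  · refine (finite_boxes hh).subset ?_
    rw [stack, Set.union_sdiff_right]
    exact Set.sdiff_subset

theorem IsThreeDPartition.finite_column {π : Set (ℕ × ℕ × ℕ)}
    (hπ : IsThreeDPartition ⊥ μ α π) {i j : ℕ} (hij : (i, j) ∉ α) :
    ∃ m, ∀ k, (i, j, k) ∈ π ↔ k < m := by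
  classical
  have hex : ∃ m, (i, j, m) ∉ π := by
    by_contra hall
    push Not at hall
    -- The second leg meets this column in finitely many heights, so an infinite column would have
    -- infinitely many boxes outside the legs.
    have hinf : {k : ℕ | (k, i) ∉ μ}.Infinite := by
      have : {k : ℕ | (k, i) ∈ μ}.Finite := by
        refine (Set.finite_Iio (μ.colLen i)).subset fun k hk => ?_
        exact YoungDiagram.mem_iff_lt_colLen.1 hk
      exact this.infinite_compl
    refine hinf (Set.Finite.of_finite_image (f := fun k => ((i, j, k) : ℕ × ℕ × ℕ))
      (hπ.finite_diff.subset ?_) fun k _ k' _ h => by simpa using h)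
    rintro _ ⟨k, hk, rfl⟩
    refine ⟨hall k, fun h => ?_⟩
    exact (mem_legs.1 h).elim hk hij
  refine ⟨Nat.find hex, fun k => ⟨fun hk => ?_, fun hk => not_not.1 (Nat.find_min hex hk)⟩⟩
  by_contra hc
  refine Nat.find_spec hex (hπ.isLowerSet ?_ hk)
  exact ⟨le_rfl, le_rfl, not_lt.1 hc⟩

/-- Lowering a coordinate stays in `π`, and as long as the segment stays clear of the legs its
length is at most the number of extra boxes. The extra 1 in the first direction keeps the segment
off the single-box leg. -/
theorem IsThreeDPartition.box_lt {π : Set (ℕ × ℕ × ℕ)} (hπ : IsThreeDPartition ⊥ μ α π)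
    (hμ : ∀ z ∈ μ, z = (0, 0)) {i j k : ℕ} (hb : (i, j, k) ∈ π \ legs ⊥ μ α) :
    i < α.colLen 0 + 1 + (π \ legs ⊥ μ α).ncard ∧ j < α.rowLen 0 + (π \ legs ⊥ μ α).ncard := by
  classical
  have key : ∀ (f : ℕ → ℕ × ℕ × ℕ) (s t : ℕ), Function.Injective f →
      (∀ u, s ≤ u → u ≤ t → f u ∈ π \ legs ⊥ μ α) → t < s + (π \ legs ⊥ μ α).ncard := by
    intro f s t hf h
    have hsub : ((Finset.Icc s t).image f : Set (ℕ × ℕ × ℕ)) ⊆ π \ legs ⊥ μ α := by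
      intro x hx
      simp only [Finset.coe_image, Set.mem_image, Finset.mem_coe, Finset.mem_Icc] at hx
      obtain ⟨u, ⟨h1, h2⟩, rfl⟩ := hx
      exact h u h1 h2
    have hc := Set.ncard_le_ncard hsub hπ.finite_diff
    rw [Set.ncard_coe_finset, Finset.card_image_of_injective _ hf, Nat.card_Icc] at hc
    omega
  have hb2 : (k, i) ∉ μ ∧ (i, j) ∉ α := not_or.1 (mt mem_legs.2 hb.2)
  constructor
  · refine key (fun u => (u, j, k)) _ i (fun u v h => by simpa using h) fun u hu hui => ?_
    refine ⟨hπ.isLowerSet (show ((u, j, k) : ℕ × ℕ × ℕ) ≤ (i, j, k) from ⟨hui, le_rfl, le_rfl⟩)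
      hb.1, fun h => ?_⟩
    rcases mem_legs.1 h with h | h
    · have := hμ _ h
      simp at this
      omega
    · have := YoungDiagram.mem_iff_lt_colLen.1 (α.up_left_mem le_rfl (Nat.zero_le j) h)
      omega
  · refine key (fun u => (i, u, k)) _ j (fun u v h => by simpa using h) fun u hu huj => ?_
    refine ⟨hπ.isLowerSet (show ((i, u, k) : ℕ × ℕ × ℕ) ≤ (i, j, k) from ⟨le_rfl, huj, le_rfl⟩)
      hb.1, fun h => ?_⟩
    rcases mem_legs.1 h with h | h
    · exact hb2.1 h
    · have := YoungDiagram.mem_iff_lt_rowLen.1 (α.up_left_mem (Nat.zero_le i) le_rfl h)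
      omega

/-- The array records column heights. Its last property says that boxes of the second leg are
counted in `h` too, which the equality of sets does not reveal. -/
theorem IsThreeDPartition.exists_eq_stack {π : Set (ℕ × ℕ × ℕ)} (hπ : IsThreeDPartition ⊥ μ α π)
    (hμ : ∀ z ∈ μ, z = (0, 0)) (ha : α.colLen 0 + 1 + (π \ legs ⊥ μ α).ncard ≤ a)
    (hb : α.rowLen 0 + (π \ legs ⊥ μ α).ncard ≤ b) :
    ∃ h ∈ skewPP a b α, π = stack μ α h ∧
      ∀ i < a, ∀ j < b, (i, j) ∉ α → ∀ k, (i, j, k) ∈ π ↔ k < h (i, j) := by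
  classical
  have hex : ∀ z : ℕ × ℕ, ∃ m, z ∉ α → ∀ k, (z.1, z.2, k) ∈ π ↔ k < m := by
    intro z
    by_cases hz : z ∈ α
    · exact ⟨0, fun h => absurd hz h⟩
    · obtain ⟨m, hm⟩ := hπ.finite_column (i := z.1) (j := z.2) hz
      exact ⟨m, fun _ => hm⟩
  choose m hm using hex
  set h : ℕ × ℕ → ℕ := fun z => if (z.1 < a ∧ z.2 < b) ∧ z ∉ α then m z else 0 with hh
  have hspec : ∀ i < a, ∀ j < b, (i, j) ∉ α → ∀ k, (i, j, k) ∈ π ↔ k < h (i, j) := by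
    intro i hi j hj hij k
    rw [hh]
    simp only [hi, hj, hij, not_false_eq_true, and_self, if_true]
    exact hm (i, j) hij k
  have hanti : ∀ i j i' j', (i, j) ∉ α → i ≤ i' → j ≤ j' → h (i', j') ≤ h (i, j) := by
    intro i j i' j' hij hi hj
    by_contra hc
    push Not at hc
    have h0 : h (i', j') ≠ 0 := by omega
    have h1 : (i' < a ∧ j' < b) ∧ (i', j') ∉ α := by
      by_contra hn
      exact h0 (if_neg hn)
    have h2 := (hspec i' h1.1.1 j' h1.1.2 h1.2 (h (i, j))).2 hc
    have h3 : (i, j, h (i, j)) ∈ π := hπ.isLowerSet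
      (show ((i, j, h (i, j)) : ℕ × ℕ × ℕ) ≤ (i', j', h (i, j)) from ⟨hi, hj, le_rfl⟩) h2
    have h4 := (hspec i (by omega) j (by omega) hij _).1 h3
    omega
  refine ⟨h, ⟨fun x y h0 => ?_, fun x y hxy => ⟨?_, ?_⟩⟩, ?_, hspec⟩
  · by_contra hn
    exact h0 (if_neg hn)
  · exact hanti _ _ _ _ hxy (Nat.le_succ x) le_rfl
  · exact hanti _ _ _ _ hxy le_rfl (Nat.le_succ y)
  · ext ⟨i, j, k⟩
    rw [mem_stack]
    constructor
    · intro ht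
      by_cases hl : (i, j, k) ∈ legs ⊥ μ α
      · exact Or.inr (mem_legs.1 hl)
      · have h1 := hπ.box_lt hμ ⟨ht, hl⟩
        have h2 : (k, i) ∉ μ ∧ (i, j) ∉ α := not_or.1 (mt mem_legs.2 hl)
        exact Or.inl ((hspec i (by omega) j (by omega) h2.2 k).1 ht)
    · rintro (ht | ht)
      · have h1 : (i < a ∧ j < b) ∧ (i, j) ∉ α := by
          by_contra hn
          have : h (i, j) = 0 := if_neg hn
          omega
        exact (hspec i h1.1.1 j h1.1.2 h1.2 k).2 ht
      · exact hπ.legs_subset (mem_legs.2 ht)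

theorem overlap_bot_bot : overlap ⊥ ⊥ α = 0 := by
  have : ∀ t : ℕ × ℕ × ℕ, legMult ⊥ ⊥ α t - 1 = 0 := by
    intro t
    simp only [legMult, leg₁, leg₂, leg₃, Set.mem_ofPred_eq, YoungDiagram.notMem_bot, if_false]
    by_cases h : (t.1, t.2.1) ∈ α <;> simp [h]
  rw [overlap]
  simp only [this, finsum_zero]

/-- The doubly covered boxes are `(0, j, 0)` with `(0, j) ∈ α`. -/
theorem overlap_bot_oneBox : overlap ⊥ oneBox α = α.rowLen 0 := by
  classical
  have h1 : ∀ t : ℕ × ℕ × ℕ, legMult ⊥ oneBox α t - 1 =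
      if t ∈ (Finset.range (α.rowLen 0)).image (fun j => ((0, j, 0) : ℕ × ℕ × ℕ)) then 1 else 0 := by
    rintro ⟨i, j, k⟩
    simp only [legMult, leg₁, leg₂, leg₃, Set.mem_ofPred_eq, YoungDiagram.notMem_bot, if_false,
      mem_oneBox, Prod.mk.injEq, Finset.mem_image, Finset.mem_range]
    by_cases h2 : k = 0 ∧ i = 0
    · obtain ⟨rfl, rfl⟩ := h2
      by_cases h3 : (0, j) ∈ α
      · have := YoungDiagram.mem_iff_lt_rowLen.1 h3
        simp [h3, this]
      · have := mt YoungDiagram.mem_iff_lt_rowLen.2 h3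
        simp [h3]
        omega
    · rw [if_neg h2, if_neg]
      · by_cases h : (i, j) ∈ α <;> simp [h]
      · rintro ⟨j', -, rfl, rfl, rfl⟩
        exact h2 ⟨rfl, rfl⟩
  rw [overlap]
  simp only [h1]
  rw [finsum_eq_sum_of_support_subset (s := (Finset.range (α.rowLen 0)).image
    (fun j => ((0, j, 0) : ℕ × ℕ × ℕ)))]
  · rw [Finset.sum_ite_mem, Finset.inter_self, Finset.sum_const, smul_eq_mul, mul_one,
      Finset.card_image_of_injective _ (fun u v h => by simpa using h), Finset.card_range]
  · intro t ht
    by_contra hc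
    exact ht (if_neg hc)

theorem ncard_threeDPartitions_bot (m : ℤ) (ha : α.colLen 0 + 1 + m ≤ a)
    (hb : α.rowLen 0 + m ≤ b) : (threeDPartitions ⊥ ⊥ α m).ncard = countPP a b α m := by
  have hdiff : ∀ h ∈ skewPP a b α,
      stack ⊥ α h \ legs ⊥ ⊥ α = {t | t.2.2 < h (t.1, t.2.1)} := by
    intro h hh
    rw [stack, Set.union_sdiff_right, sdiff_eq_left, Set.disjoint_left]
    rintro ⟨i, j, k⟩ ht hl
    rcases mem_legs.1 hl with hl | hl
    · exact YoungDiagram.notMem_bot _ hl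
    · have ht' : k < h (i, j) := ht
      exact (hh.1 i j (by omega)).2 hl
  have hsize : ∀ h ∈ skewPP a b α, normSize ⊥ ⊥ α (stack ⊥ α h) = total a b h := by
    intro h hh
    rw [normSize, hdiff h hh, ncard_boxes hh, overlap_bot_bot, Nat.cast_zero, sub_zero]
  rw [countPP, ← Set.InjOn.ncard_image (f := stack ⊥ α)]
  · congr 1
    ext π
    simp only [threeDPartitions, Set.mem_ofPred_eq, Set.mem_image]
    constructor
    · rintro ⟨hπ, hm⟩
      rw [normSize, overlap_bot_bot, Nat.cast_zero, sub_zero] at hm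
      obtain ⟨h, hh, rfl, -⟩ := hπ.exists_eq_stack (a := a) (b := b)
        (fun z hz => absurd hz (YoungDiagram.notMem_bot z)) (by omega) (by omega)
      rw [hdiff h hh, ncard_boxes hh] at hm
      exact ⟨h, ⟨hh, hm⟩, rfl⟩
    · rintro ⟨h, ⟨hh, hm⟩, rfl⟩
      exact ⟨isThreeDPartition_stack hh, by rw [hsize h hh, hm]⟩
  · rintro h ⟨hh, -⟩ h' ⟨hh', -⟩ heq
    have h1 : {t : ℕ × ℕ × ℕ | t.2.2 < h (t.1, t.2.1)} = {t | t.2.2 < h' (t.1, t.2.1)} := by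
      rw [← hdiff h hh, ← hdiff h' hh', heq]
    funext ⟨i, j⟩
    refine eq_of_forall_lt_iff fun k => ?_
    exact Set.ext_iff.1 h1 (i, j, k)

/-- The heights count the b + 1 - λ_0 leg boxes `(0, j, 0)` with λ_0 ≤ j ≤ b; together with the
overlap λ_0 this shifts the size by b + 1. Positivity along row 0 makes `h` recoverable from its
stack. -/
theorem ncard_threeDPartitions_oneBox (n : ℤ) (ha : α.colLen 0 + 1 + α.rowLen 0 + n ≤ a)
    (ha0 : 0 < a) (hb : 2 * α.rowLen 0 + n ≤ b + 1) (hb0 : α.rowLen 0 ≤ b) :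
    (threeDPartitions ⊥ oneBox α n).ncard =
      {h | (h ∈ skewPP a (b + 1) α ∧ (total a (b + 1) h : ℤ) = n + b + 1) ∧
        h (0, b) ≠ 0}.ncard := by
  classical
  have hpos : ∀ h ∈ skewPP a (b + 1) α, h (0, b) ≠ 0 → ∀ j ≤ b, (0, j) ∉ α → 0 < h (0, j) := by
    intro h hh h0 j hj hjα
    have := skewPP_antitone hh hjα le_rfl hj
    omega
  have hdiff : ∀ h ∈ skewPP a (b + 1) α, h (0, b) ≠ 0 →
      stack oneBox α h \ legs ⊥ oneBox α = {t | t.2.2 < h (t.1, t.2.1)} \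
        ((Finset.Icc (α.rowLen 0) b).image (fun j => ((0, j, 0) : ℕ × ℕ × ℕ)) : Finset _) := by
    intro h hh h0
    rw [stack, Set.union_sdiff_right]
    ext ⟨i, j, k⟩
    simp only [Set.mem_sdiff, Set.mem_ofPred_eq, mem_legs, mem_oneBox, Prod.mk.injEq, not_or,
      Finset.coe_image, Set.mem_image, Finset.mem_coe, Finset.mem_Icc, not_exists, not_and]
    refine and_congr_right fun hk => ?_
    have h1 := hh.1 i j (by omega)
    constructor
    · rintro ⟨h2, -⟩ j' - h3 h4
      exact fun h5 => h2 h5.symm h3.symm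
    · intro h2
      refine ⟨fun hk0 hi0 => ?_, h1.2⟩
      subst hk0 hi0
      have := mt YoungDiagram.mem_iff_lt_rowLen.2 h1.2
      exact h2 j ⟨by omega, by omega⟩ rfl rfl rfl
  have hsize : ∀ h ∈ skewPP a (b + 1) α, h (0, b) ≠ 0 →
      normSize ⊥ oneBox α (stack oneBox α h) = total a (b + 1) h - (b + 1) := by
    intro h hh h0
    have hsub : (((Finset.Icc (α.rowLen 0) b).image (fun j => ((0, j, 0) : ℕ × ℕ × ℕ)) :
        Finset _) : Set (ℕ × ℕ × ℕ)) ⊆ {t | t.2.2 < h (t.1, t.2.1)} := by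
      intro t ht
      simp only [Finset.coe_image, Set.mem_image, Finset.mem_coe, Finset.mem_Icc] at ht
      obtain ⟨j, hj, rfl⟩ := ht
      refine hpos h hh h0 j hj.2 fun hα => ?_
      have := YoungDiagram.mem_iff_lt_rowLen.1 hα
      omega
    have h1 := Set.ncard_sdiff_add_ncard_of_subset hsub (finite_boxes hh)
    rw [ncard_boxes hh, Set.ncard_coe_finset, Finset.card_image_of_injective _
      (fun u v h => by simpa using h), Nat.card_Icc] at h1
    rw [normSize, hdiff h hh h0, overlap_bot_oneBox]
    omega
  rw [← Set.InjOn.ncard_image (f := stack oneBox α)]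
  · congr 1
    ext π
    simp only [threeDPartitions, Set.mem_ofPred_eq, Set.mem_image]
    constructor
    · rintro ⟨hπ, hm⟩
      have hm' := hm
      rw [normSize, overlap_bot_oneBox] at hm
      obtain ⟨h, hh, rfl, hspec⟩ := hπ.exists_eq_stack (a := a) (b := b + 1)
        (fun z hz => mem_oneBox.1 hz) (by omega) (by omega)
      have h0 : h (0, b) ≠ 0 := by
        have h1 : (0, b) ∉ α := fun h => by
          have := YoungDiagram.mem_iff_lt_rowLen.1 h
          omega
        have h2 := (hspec 0 ha0 b (Nat.lt_succ_self b) h1 0).1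
          (mem_stack.2 (Or.inr (Or.inl (mem_oneBox.2 rfl))))
        omega
      rw [hsize h hh h0] at hm'
      exact ⟨h, ⟨⟨hh, by omega⟩, h0⟩, rfl⟩
    · rintro ⟨h, ⟨⟨hh, hm⟩, h0⟩, rfl⟩
      exact ⟨isThreeDPartition_stack hh, by rw [hsize h hh h0, hm]; ring⟩
  · rintro h ⟨⟨hh, -⟩, h0⟩ h' ⟨⟨hh', -⟩, h0'⟩ heq
    have key : ∀ h ∈ skewPP a (b + 1) α, h (0, b) ≠ 0 → ∀ i j, (i, j) ∉ α → j ≤ b → ∀ k,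
        ((i, j, k) ∈ stack oneBox α h ↔ k < h (i, j)) := by
      intro h hh h0 i j hij hj k
      rw [mem_stack, mem_oneBox]
      simp only [Prod.mk.injEq, hij, or_false, or_iff_left_iff_imp]
      rintro ⟨rfl, rfl⟩
      exact hpos h hh h0 j hj hij
    funext ⟨i, j⟩
    by_cases hin : (i, j) ∉ α ∧ j ≤ b
    · refine eq_of_forall_lt_iff fun k => ?_
      rw [← key h hh h0 i j hin.1 hin.2, ← key h' hh' h0' i j hin.1 hin.2, heq]
    · have hz : ∀ h ∈ skewPP a (b + 1) α, h (i, j) = 0 := by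
        intro h hh
        by_contra hc
        have := hh.1 i j hc
        exact hin ⟨this.2, by omega⟩
      rw [hz h hh, hz h' hh']

end Boxes

/-! ### The vertex ratio as a Laurent polynomial -/

/-- The integral powers of `p`. -/
noncomputable def pz (n : ℤ) : LaurentSeries ℚ := HahnSeries.single n 1

theorem pz_mul (m n : ℤ) : pz m * pz n = pz (m + n) := by
  simp [pz]

theorem pz_zero : pz 0 = 1 := rfl

theorem pz_one : pz 1 = p := rfl

theorem pz_neg_one : pz (-1) = p⁻¹ :=
  eq_inv_of_mul_eq_one_left (by rw [← pz_one, pz_mul]; rfl)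

theorem coeff_pz_mul (m n : ℤ) (x : LaurentSeries ℚ) : (pz m * x).coeff n = x.coeff (n - m) := by
  rw [pz, HahnSeries.coeff_single_mul, one_mul]

/-- The ratio `(1 - p) V_{∅ (1) α} / V_{∅ ∅ α}` in terms of the list of parts of `α`. -/
noncomputable def ratioOfParts : List ℕ → LaurentSeries ℚ
  | [] => 1
  | N :: w => (1 - p) * pz (-N) + p * ratioOfParts w

/-- Each leading part shifts the later ones by a factor p. The term p^n is the tail (1 - p) ∑_{i ≥
n} p^i coming from zero parts. -/
theorem ratioOfParts_map_range (n : ℕ) (f : ℕ → ℕ) :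
    ratioOfParts ((List.range n).map f) =
      pz n + (1 - p) * ∑ i ∈ Finset.range n, pz ((f i : ℤ) * (-1) + i) := by
  induction n generalizing f with
  | zero => simp [ratioOfParts, pz_zero]
  | succ n ih =>
    rw [List.range_succ_eq_map, List.map_cons, List.map_map, ratioOfParts, ih, Finset.sum_range_succ',
      ← pz_one, mul_add, pz_mul, mul_left_comm, Finset.mul_sum]
    simp only [pz_mul, Function.comp_apply, Nat.succ_eq_add_one]
    have h1 : (1 : ℤ) + n = ((n + 1 : ℕ) : ℤ) := by push_cast; ring
    have h2 : ∀ i : ℕ, (1 : ℤ) + ((f (i + 1) : ℤ) * (-1) + i) =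
        (f (i + 1) : ℤ) * (-1) + ((i + 1 : ℕ) : ℤ) := by intro i; push_cast; ring
    have h3 : (f 0 : ℤ) * (-1) + ((0 : ℕ) : ℤ) = -(f 0) := by push_cast; ring
    simp only [h1, h2, h3]
    ring

theorem coeff_vertex (μ₁ μ₂ μ₃ : YoungDiagram) (n : ℤ) :
    (vertex μ₁ μ₂ μ₃).coeff n = ((threeDPartitions μ₁ μ₂ μ₃ n).ncard : ℚ) := rfl

theorem coeff_vertex_of_neg (α : YoungDiagram) {n : ℤ} (hn : n < 0) :
    (vertex ⊥ ⊥ α).coeff n = 0 := by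
  rw [coeff_vertex, threeDPartitions_eq_empty _ _ _ _ (by rw [overlap_bot_bot]; exact_mod_cast hn)]
  simp

theorem rowLen_eq_zero {α : YoungDiagram} {i : ℕ} (hi : α.colLen 0 ≤ i) : α.rowLen i = 0 := by
  by_contra h
  have := YoungDiagram.mem_iff_lt_colLen.1
    (YoungDiagram.mem_iff_lt_rowLen.2 (Nat.pos_of_ne_zero h))
  omega

/-- Coefficientwise form of V_{∅(1)α} = V_{∅∅α} ∑_i p^(i - λ_i). Side lengths near 2M hold every
partition involved, and terms with i ≥ 2M would have negative index. -/
theorem coeff_vertex_oneBox (α : YoungDiagram) (n : ℤ) (M : ℕ) (hM : n ≤ M)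
    (hα : α.colLen 0 + 1 + 2 * α.rowLen 0 ≤ M) :
    (vertex ⊥ oneBox α).coeff n =
      ∑ i ∈ Finset.range (2 * M), (vertex ⊥ ⊥ α).coeff (n + α.rowLen i - i) := by
  have hrow : ∀ i, α.rowLen i ≤ α.rowLen 0 := fun i => α.rowLen_anti _ _ (Nat.zero_le i)
  by_cases hn : n < -(α.rowLen 0 : ℤ)
  · rw [coeff_vertex, threeDPartitions_eq_empty _ _ _ _ (by rw [overlap_bot_oneBox]; exact hn),
      Set.ncard_empty, Nat.cast_zero, Finset.sum_eq_zero]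
    intro i _
    have := hrow i
    exact coeff_vertex_of_neg α (by omega)
  · rw [coeff_vertex, ncard_threeDPartitions_oneBox (a := 2 * M) (b := 2 * M) n (by omega)
      (by omega) (by omega) (by omega), ncard_skewPP_ne_zero (by omega) n (by omega) (by omega),
      Nat.cast_sum]
    refine Finset.sum_congr rfl fun i _ => ?_
    have := hrow i
    rw [coeff_vertex, ncard_threeDPartitions_bot (a := 2 * M) (b := 2 * M + 1) _ (by omega)
      (by omega)]

/-- Multiplication by 1 - p makes the part of ∑_i p^(i - λ_i) beyond the last row telescope. -/
theorem one_sub_p_mul_vertex (α : YoungDiagram) :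
    (1 - p) * vertex ⊥ oneBox α = ratioOfParts α.rowLens * vertex ⊥ ⊥ α := by
  rw [YoungDiagram.rowLens, ratioOfParts_map_range, ← pz_one]
  ext n
  obtain ⟨M, hM1, hM2⟩ : ∃ M : ℕ, n ≤ M ∧ α.colLen 0 + 1 + 2 * α.rowLen 0 ≤ M :=
    ⟨max n.toNat (α.colLen 0 + 1 + 2 * α.rowLen 0), by omega, by omega⟩
  set V := vertex ⊥ ⊥ α with hV
  have hR : ((pz (α.colLen 0) + (1 - pz 1) * ∑ i ∈ Finset.range (α.colLen 0),
      pz ((α.rowLen i : ℤ) * (-1) + i)) * V).coeff n =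
      V.coeff (n - α.colLen 0) + ∑ i ∈ Finset.range (α.colLen 0),
        (V.coeff (n + α.rowLen i - i) - V.coeff (n - 1 + α.rowLen i - i)) := by
    rw [sub_mul, one_mul, Finset.mul_sum, add_mul, sub_mul, Finset.sum_mul, Finset.sum_mul]
    simp only [pz_mul, HahnSeries.coeff_add, HahnSeries.coeff_sub, HahnSeries.coeff_sum,
      coeff_pz_mul, Finset.sum_sub_distrib]
    congr 1
    congr 1 <;> refine Finset.sum_congr rfl fun i _ => ?_ <;> congr 1 <;> ring
  rw [hR, sub_mul, one_mul, HahnSeries.coeff_sub, coeff_pz_mul,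
    coeff_vertex_oneBox α n M hM1 hM2, coeff_vertex_oneBox α (n - 1) M (by omega) hM2, ← hV,
    ← Finset.sum_sub_distrib,
    ← Finset.sum_range_add_sum_Ico _ (show α.colLen 0 ≤ 2 * M by omega), add_comm]
  congr 1
  have h1 : ∀ i ∈ Finset.Ico (α.colLen 0) (2 * M),
      V.coeff (n + α.rowLen i - i) - V.coeff (n - 1 + α.rowLen i - i) =
        V.coeff (n - i) - V.coeff (n - (i + 1 : ℕ)) := by
    intro i hi
    rw [rowLen_eq_zero (Finset.mem_Ico.1 hi).1]
    congr 2 <;> push_cast <;> ring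
  rw [Finset.sum_congr rfl h1, Finset.sum_Ico_eq_sum_range,
    ← neg_inj, ← Finset.sum_neg_distrib]
  have h2 := Finset.sum_range_sub (fun i => V.coeff (n - (α.colLen 0 + i : ℕ)))
    (2 * M - α.colLen 0)
  simp only [neg_sub]
  refine (h2.trans ?_)
  -- The far end of the telescoping sum vanishes because n ≤ M < 2M.
  rw [Nat.add_sub_cancel' (by omega), hV, coeff_vertex_of_neg α (n := n - (2 * M : ℕ)) (by omega)]
  simp

theorem vertexRatio_eq (α : YoungDiagram) : vertexRatio α = ratioOfParts α.rowLens := by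
  rw [vertexRatio, ← mul_div_assoc, one_sub_p_mul_vertex, mul_div_assoc,
    div_self (vertex_ne_zero _ _ _), mul_one]

/-! ### Generating functions over partitions with bounded parts -/

/-- The partitions of `a` with parts at most `N`, as weakly decreasing lists of parts. -/
def boundedParts (N a : ℕ) : Set (List ℕ) :=
  {w | w.Pairwise (· ≥ ·) ∧ (∀ x ∈ w, 0 < x ∧ x ≤ N) ∧ w.sum = a}

theorem length_le_sum {w : List ℕ} (hw : ∀ x ∈ w, 0 < x) : w.length ≤ w.sum := by
  induction w with
  | nil => simp
  | cons x w ih =>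
    have h1 := ih fun y hy => hw y (List.mem_cons_of_mem _ hy)
    have h2 := hw x List.mem_cons_self
    simp only [List.length_cons, List.sum_cons]
    omega

theorem finite_boundedParts (N a : ℕ) : (boundedParts N a).Finite := by
  refine ((List.finite_length_le (Fin (N + 1)) a).image (List.map Fin.val)).subset ?_
  rintro w ⟨-, h2, h3⟩
  refine ⟨w.pmap (fun x hx => ⟨x, hx⟩) (fun x hx => Nat.lt_succ_of_le (h2 x hx).2), ?_, ?_⟩
  · have := length_le_sum fun x hx => (h2 x hx).1
    simp only [Set.mem_ofPred_eq, List.length_pmap]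
    omega
  · rw [List.map_pmap]
    simp

theorem boundedParts_zero (a : ℕ) : boundedParts 0 a = if a = 0 then {[]} else ∅ := by
  have h1 : ∀ w ∈ boundedParts 0 a, w = [] := by
    rintro (_ | ⟨x, w⟩) ⟨-, h2, -⟩
    · rfl
    · have := h2 x List.mem_cons_self
      omega
  ext w
  split_ifs with h
  · subst h
    exact ⟨h1 w, by rintro rfl; exact ⟨by simp, by simp, rfl⟩⟩
  · simp only [Set.mem_empty_iff_false, iff_false]
    intro hw
    have := h1 w hw
    subst this
    exact h hw.2.2.symm

/-- A decreasing list with parts at most N + 1 either avoids N + 1 or starts with it, and its tail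
may use N + 1 again. -/
theorem boundedParts_succ (N a : ℕ) :
    boundedParts (N + 1) a = boundedParts N a ∪
      (if N + 1 ≤ a then List.cons (N + 1) '' boundedParts (N + 1) (a - (N + 1)) else ∅) := by
  ext w
  constructor
  · rintro ⟨h1, h2, h3⟩
    rcases w with _ | ⟨x, w⟩
    · exact Or.inl ⟨h1, by simp, h3⟩
    · have hx := h2 x List.mem_cons_self
      rw [List.pairwise_cons] at h1
      rw [List.sum_cons] at h3
      rcases Nat.lt_or_ge N x with hN | hN
      · have : x = N + 1 := by omega
        subst this
        right
        rw [if_pos (by omega)]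
        exact ⟨w, ⟨h1.2, fun y hy => h2 y (List.mem_cons_of_mem _ hy), by omega⟩, rfl⟩
      · refine Or.inl ⟨List.pairwise_cons.2 h1, fun y hy => ⟨(h2 y hy).1, ?_⟩,
          by rw [List.sum_cons, h3]⟩
        rcases List.mem_cons.1 hy with rfl | hy
        · exact hN
        · exact (h1.1 y hy).trans hN
  · rintro (⟨h1, h2, h3⟩ | hw)
    · exact ⟨h1, fun x hx => ⟨(h2 x hx).1, (h2 x hx).2.trans (Nat.le_succ N)⟩, h3⟩
    · split_ifs at hw with h
      · obtain ⟨v, ⟨h1, h2, h3⟩, rfl⟩ := hw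
        refine ⟨List.pairwise_cons.2 ⟨fun x hx => (h2 x hx).2, h1⟩, fun x hx => ?_, ?_⟩
        · rcases List.mem_cons.1 hx with rfl | hx
          · exact ⟨Nat.succ_pos _, le_rfl⟩
          · exact h2 x hx
        · rw [List.sum_cons, h3]
          omega
      · exact absurd hw (Set.notMem_empty _)

section PartsGF

variable {L : Type*} [CommRing L]

/-- The generating function of the statistic `f` over partitions with parts at most `N`. -/
noncomputable def partsGF (f : List ℕ → L) (N : ℕ) : PowerSeries L :=
  PowerSeries.mk fun a => ∑ w ∈ (finite_boundedParts N a).toFinset, f w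

theorem partsGF_zero (f : List ℕ → L) : partsGF f 0 = PowerSeries.C (f []) := by
  classical
  ext a
  rw [partsGF, PowerSeries.coeff_mk, PowerSeries.coeff_C]
  have := boundedParts_zero a
  split_ifs with h
  · rw [if_pos h] at this
    have h1 : (finite_boundedParts 0 a).toFinset = {[]} := by
      ext w
      rw [Set.Finite.mem_toFinset, this]
      simp
    rw [h1, Finset.sum_singleton]
  · rw [if_neg h] at this
    refine Finset.sum_eq_zero fun w hw => ?_
    rw [Set.Finite.mem_toFinset, this] at hw
    exact absurd hw (Set.notMem_empty _)

theorem partsGF_succ (f : List ℕ → L) (N : ℕ) :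
    partsGF f (N + 1) = partsGF f N +
      PowerSeries.X ^ (N + 1) * partsGF (fun w => f ((N + 1) :: w)) (N + 1) := by
  classical
  ext a
  rw [map_add, PowerSeries.coeff_X_pow_mul']
  simp only [partsGF, PowerSeries.coeff_mk]
  have hmem : ∀ w, w ∈ (finite_boundedParts (N + 1) a).toFinset ↔
      w ∈ (finite_boundedParts N a).toFinset ∪ (if N + 1 ≤ a then
        (finite_boundedParts (N + 1) (a - (N + 1))).toFinset.image (List.cons (N + 1)) else ∅) := by
    intro w
    rw [Set.Finite.mem_toFinset, boundedParts_succ, Finset.mem_union, Set.mem_union,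
      Set.Finite.mem_toFinset]
    split_ifs <;> simp
  rw [Finset.ext hmem, Finset.sum_union]
  · split_ifs
    · rw [Finset.sum_image fun u _ v _ h => by simpa using h]
    · simp
  · rw [Finset.disjoint_left]
    intro w hw hw'
    split_ifs at hw'
    · obtain ⟨v, -, rfl⟩ := Finset.mem_image.1 hw'
      rw [Set.Finite.mem_toFinset] at hw
      have := (hw.2.1 (N + 1) List.mem_cons_self).2
      omega
    · simp at hw'

theorem partsGF_add (f g : List ℕ → L) (N : ℕ) :
    partsGF (fun w => f w + g w) N = partsGF f N + partsGF g N := by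
  ext a
  simp [partsGF, Finset.sum_add_distrib]

theorem partsGF_mul (k : L) (f : List ℕ → L) (N : ℕ) :
    partsGF (fun w => k * f w) N = PowerSeries.C k * partsGF f N := by
  ext a
  simp [partsGF, Finset.mul_sum]

end PartsGF

/-- `ratioOfParts` is affine in the tail of the list, so the recursion closes up with the plain
partition count. -/
theorem partsGF_ratio_succ (N : ℕ) :
    partsGF ratioOfParts (N + 1) = partsGF ratioOfParts N + PowerSeries.X ^ (N + 1) *
      (PowerSeries.C ((1 - p) * pz (-((N + 1 : ℕ) : ℤ))) * partsGF (fun _ => 1) (N + 1) +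
        PowerSeries.C p * partsGF ratioOfParts (N + 1)) := by
  rw [← partsGF_mul, ← partsGF_mul, ← partsGF_add, partsGF_succ]
  simp only [ratioOfParts, mul_one]

theorem card_eq_sum_rowLens (α : YoungDiagram) : α.card = α.rowLens.sum := by
  classical
  have h1 : ∀ (f : ℕ → ℕ) (n : ℕ), ((List.range n).map f).sum = ∑ i ∈ Finset.range n, f i := by
    intro f n
    induction n with
    | zero => rfl
    | succ n ih => simp [List.range_succ, Finset.sum_range_succ, ih]
  rw [YoungDiagram.rowLens, h1, YoungDiagram.card,
    Finset.card_eq_sum_card_fiberwise (f := Prod.fst) (t := Finset.range (α.colLen 0))]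
  · refine Finset.sum_congr rfl fun i _ => ?_
    rw [YoungDiagram.rowLen_eq_card]
    rfl
  · rintro ⟨i, j⟩ h
    simp only [Finset.coe_range, Set.mem_Iio]
    exact YoungDiagram.mem_iff_lt_colLen.1 (α.up_left_mem le_rfl (Nat.zero_le j) h)

/-- Parts of a partition of `a` are at most `a ≤ N`, so bounding them by `N` is no restriction. -/
theorem F_eq_coeff {a N : ℕ} (ha : a ≤ N) :
    F a = PowerSeries.coeff a (partsGF ratioOfParts N) := by
  rw [F, partsGF, PowerSeries.coeff_mk]
  refine Finset.sum_bij (fun α _ => α.rowLens) ?_ ?_ ?_ ?_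
  · intro α hα
    rw [Set.Finite.mem_toFinset] at hα ⊢
    have hα' : α.card = a := hα
    refine ⟨α.rowLens_sorted.pairwise, fun x hx => ⟨α.pos_of_mem_rowLens x hx, ?_⟩,
      by rw [← card_eq_sum_rowLens, hα']⟩
    have := List.single_le_sum (fun _ _ => Nat.zero_le _) x hx
    rw [← card_eq_sum_rowLens, hα'] at this
    omega
  · intro α _ β _ h
    exact YoungDiagram.equivListRowLens.injective (Subtype.ext h)
  · intro w hw
    rw [Set.Finite.mem_toFinset] at hw
    have hs : w.SortedGE := hw.1.sortedGE
    have hr := YoungDiagram.rowLens_ofRowLens_eq_self (hw := hs) (fun x hx => (hw.2.1 x hx).1)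
    refine ⟨YoungDiagram.ofRowLens w hs, ?_, hr⟩
    rw [Set.Finite.mem_toFinset]
    change YoungDiagram.card _ = a
    rw [card_eq_sum_rowLens, hr, hw.2.2]
  · intro α _
    exact vertexRatio_eq α

/-! ### A truncated q-binomial theorem -/

section QBinomial

variable {R : Type*} [CommRing R]

/-- Truncation of the functional equation (1 - y) f(y) = (1 - c y) f(q y) for f(y) = ∑ h_j y^j: the
recurrence for `h` cancels all terms but the last. -/
theorem qBinomial_step (h : ℕ → R) (q c y : R)
    (hh : ∀ j, h (j + 1) * (1 - q ^ (j + 1)) = h j * (1 - c * q ^ j)) (N : ℕ) :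
    (1 - y) * ∑ j ∈ Finset.range (N + 1), h j * y ^ j -
        (1 - c * y) * ∑ j ∈ Finset.range (N + 1), h j * (y * q) ^ j =
      -(h (N + 1) * (1 - q ^ (N + 1)) * y ^ (N + 1)) := by
  induction N with
  | zero =>
    have := hh 0
    simp only [zero_add, Finset.range_one, Finset.sum_singleton, pow_zero, mul_one, pow_one] at *
    linear_combination y * this
  | succ N ih =>
    rw [Finset.sum_range_succ (n := N + 1), Finset.sum_range_succ (n := N + 1)]
    have := hh (N + 1)
    linear_combination ih + y ^ (N + 2) * this

/-- The `q`-binomial theorem at `c x = q`, up to `q ^ (N + 1)`. -/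
theorem qBinomial_dvd (h : ℕ → R) (q c k : R) (hck : c * k = 1) (h0 : h 0 = 1)
    (hh : ∀ j, h (j + 1) * (1 - q ^ (j + 1)) = h j * (1 - c * q ^ j)) (N : ℕ) :
    q ^ (N + 1) ∣ (∑ j ∈ Finset.range (N + 1), h j * (k * q) ^ j) *
      ∏ m ∈ Finset.range N, (1 - k * q ^ (m + 1)) - ∏ m ∈ Finset.range N, (1 - q ^ (m + 1)) := by
  -- The functional equation is iterated from y = kq; since ck = 1, the factors 1 - cy are 1 -
  -- q^(n+1).
  have key : ∀ n, q ^ (N + 1) ∣ (∑ j ∈ Finset.range (N + 1), h j * (k * q) ^ j) *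
      ∏ m ∈ Finset.range n, (1 - k * q ^ (m + 1)) -
        (∏ m ∈ Finset.range n, (1 - q ^ (m + 1))) *
          ∑ j ∈ Finset.range (N + 1), h j * (k * q ^ (n + 1)) ^ j := by
    intro n
    induction n with
    | zero => simp
    | succ n ih =>
      obtain ⟨u, hu⟩ := ih
      have h1 := qBinomial_step h q c (k * q ^ (n + 1)) hh N
      have h2 : k * q ^ (n + 1) * q = k * q ^ (n + 1 + 1) := by ring
      have h3 : c * (k * q ^ (n + 1)) = q ^ (n + 1) := by rw [← mul_assoc, hck, one_mul]
      rw [h2, h3] at h1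
      -- The new error contains y^(N+1) with y = k q^(n+1), which is q^(N+1) (k q^n)^(N+1).
      refine ⟨u * (1 - k * q ^ (n + 1)) - (∏ m ∈ Finset.range n, (1 - q ^ (m + 1))) *
        (h (N + 1) * (1 - q ^ (N + 1)) * (k * q ^ n) ^ (N + 1)), ?_⟩
      rw [Finset.prod_range_succ, Finset.prod_range_succ]
      linear_combination (1 - k * q ^ (n + 1)) * hu +
        (∏ m ∈ Finset.range n, (1 - q ^ (m + 1))) * h1
  have h1 : q ^ (N + 1) ∣ ∑ j ∈ Finset.range (N + 1), h j * (k * q ^ (N + 1)) ^ j - 1 := by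
    rw [Finset.sum_range_succ', h0, pow_zero, mul_one, add_sub_cancel_right]
    refine Finset.dvd_sum fun j _ => ?_
    refine Dvd.dvd.mul_left ?_ _
    rw [pow_succ (k * q ^ (N + 1))]
    exact ⟨(k * q ^ (N + 1)) ^ j * k, by ring⟩
  have h2 := dvd_add (key N) (Dvd.dvd.mul_left h1 (∏ m ∈ Finset.range N, (1 - q ^ (m + 1))))
  convert h2 using 1
  ring

end QBinomial

/-! ### Summing the vertex ratio over partitions -/

open PowerSeries in
/-- The coefficients `(p; q)_j / (q; q)_j`. -/
noncomputable def qRatio (j : ℕ) : PowerSeries (LaurentSeries ℚ) :=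
  partsGF (fun _ => 1) j * ∏ m ∈ Finset.range j, (1 - C p * X ^ m)

-- For the constant statistic, `partsGF_succ` reads P_{j+1} (1 - q^(j+1)) = P_j.
open PowerSeries in
theorem qRatio_succ (j : ℕ) :
    qRatio (j + 1) * (1 - X ^ (j + 1)) = qRatio j * (1 - C p * X ^ j) := by
  have h := partsGF_succ (fun _ => (1 : LaurentSeries ℚ)) j
  rw [qRatio, qRatio, Finset.prod_range_succ]
  linear_combination (∏ m ∈ Finset.range j, (1 - C p * X ^ m)) * (1 - C p * X ^ j) * h

theorem pz_neg_natCast (n : ℕ) : pz (-(n : ℤ)) = p⁻¹ ^ n := by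
  rw [← pz_neg_one, pz, pz, HahnSeries.single_pow]
  simp

-- The recursion of `partsGF_ratio_succ` cleared of denominators: its factor 1 - p completes
-- ∏_{m=1}^{N} (1 - p q^m) to (p;q)_{N+1}, the numerator of the new term.
open PowerSeries in
theorem partsGF_ratio_mul_prod (N : ℕ) :
    partsGF ratioOfParts N * ∏ m ∈ Finset.range N, (1 - C p * X ^ (m + 1)) =
      ∑ j ∈ Finset.range (N + 1), qRatio j * (C p⁻¹ * X) ^ j := by
  induction N with
  | zero => simp [partsGF_zero, qRatio, ratioOfParts]
  | succ N ih =>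
    have h1 := partsGF_ratio_succ N
    have h2 : qRatio (N + 1) = partsGF (fun _ => 1) (N + 1) *
        ((∏ m ∈ Finset.range N, (1 - C p * X ^ (m + 1))) * (1 - C p)) := by
      rw [qRatio, Finset.prod_range_succ', pow_zero, mul_one]
    rw [Finset.sum_range_succ, ← ih, Finset.prod_range_succ, h2, mul_pow, ← map_pow,
      ← pz_neg_natCast]
    rw [map_mul, map_sub, map_one] at h1
    linear_combination (∏ m ∈ Finset.range N, (1 - C p * X ^ (m + 1))) * h1

theorem p_ne_zero : p ≠ 0 := by
  rw [p]
  exact HahnSeries.single_ne_zero one_ne_zero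

open PowerSeries in
theorem partsGF_ratio_dvd (N : ℕ) :
    X ^ (N + 1) ∣ partsGF ratioOfParts N * (∏ m ∈ Finset.range N, (1 - C p * X ^ (m + 1))) *
      (∏ m ∈ Finset.range N, (1 - C p⁻¹ * X ^ (m + 1))) -
        ∏ m ∈ Finset.range N, (1 - X ^ (m + 1)) := by
  rw [partsGF_ratio_mul_prod]
  refine qBinomial_dvd qRatio X (C p) (C p⁻¹) ?_ ?_ qRatio_succ N
  · rw [← map_mul, mul_inv_cancel₀ p_ne_zero, map_one]
  · simp [qRatio, partsGF_zero]

/-! ### The infinite product and convergence -/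

/-- The factors of the infinite product. -/
noncomputable def factor (m : ℕ) : PowerSeries (LaurentSeries ℚ) :=
  (1 - (PowerSeries.X : PowerSeries (LaurentSeries ℚ)) ^ (m + 1)) *
    ((1 - PowerSeries.C p * PowerSeries.X ^ (m + 1)) *
      (1 - PowerSeries.C p⁻¹ * PowerSeries.X ^ (m + 1)))⁻¹

open PowerSeries in
theorem factor_mul (m : ℕ) :
    factor m * ((1 - C p * X ^ (m + 1)) * (1 - C p⁻¹ * X ^ (m + 1))) = 1 - X ^ (m + 1) := by
  rw [factor, mul_assoc, PowerSeries.inv_mul_cancel, mul_one]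
  simp

open PowerSeries in
theorem dvd_factor_sub_one {d m : ℕ} (h : d ≤ m) : X ^ (d + 1) ∣ factor m - 1 := by
  have h1 : factor m - 1 = (1 - X ^ (m + 1) - (1 - C p * X ^ (m + 1)) *
      (1 - C p⁻¹ * X ^ (m + 1))) * ((1 - C p * X ^ (m + 1)) * (1 - C p⁻¹ * X ^ (m + 1)))⁻¹ := by
    rw [sub_mul, PowerSeries.mul_inv_cancel _ (by simp), factor]
  rw [h1]
  refine Dvd.dvd.mul_right ((pow_dvd_pow X (Nat.add_le_add_right h 1)).trans
    ⟨C p + C p⁻¹ - 1 - C p * C p⁻¹ * X ^ (m + 1), by ring⟩) _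

-- Factors of index at least `d` are 1 modulo X^(d+1), so only the first `d` matter. Dividing
-- `partsGF_ratio_dvd` by the invertible denominator `D` identifies their product with `partsGF
-- ratioOfParts d` to that order.
open PowerSeries in
theorem coeff_prod_factor (d : ℕ) (s : Finset ℕ) (hs : Finset.range d ⊆ s) :
    coeff d (∏ m ∈ s, factor m) = F d := by
  classical
  have h1 : X ^ (d + 1) ∣ (∏ m ∈ s \ Finset.range d, factor m) - 1 := by
    refine Finset.prod_induction factor (fun f => X ^ (d + 1) ∣ f - 1) ?_ (by simp) ?_
    · intro f g hf hg
      have h2 := dvd_add (Dvd.dvd.mul_left hg f) hf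
      convert h2 using 1
      ring
    · intro m hm
      refine dvd_factor_sub_one ?_
      simp only [Finset.mem_sdiff, Finset.mem_range, not_lt] at hm
      exact hm.2
  have h2 : X ^ (d + 1) ∣ (∏ m ∈ s, factor m) - ∏ m ∈ Finset.range d, factor m := by
    rw [← Finset.prod_sdiff hs]
    have h3 := Dvd.dvd.mul_left h1 (∏ m ∈ Finset.range d, factor m)
    convert h3 using 1
    ring
  set D := ∏ m ∈ Finset.range d, ((1 - C p * X ^ (m + 1)) *
    (1 - C p⁻¹ * (X : PowerSeries (LaurentSeries ℚ)) ^ (m + 1))) with hD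
  have h3 : (∏ m ∈ Finset.range d, factor m) * D = ∏ m ∈ Finset.range d, (1 - X ^ (m + 1)) := by
    rw [hD, ← Finset.prod_mul_distrib]
    exact Finset.prod_congr rfl fun m _ => factor_mul m
  have hD0 : constantCoeff D ≠ 0 := by
    rw [hD, map_prod]
    refine Finset.prod_ne_zero_iff.2 fun m _ => ?_
    simp
  have h4 : X ^ (d + 1) ∣ partsGF ratioOfParts d - ∏ m ∈ Finset.range d, factor m := by
    have h5 := Dvd.dvd.mul_right (partsGF_ratio_dvd d) D⁻¹
    rw [← h3, mul_assoc, ← Finset.prod_mul_distrib, ← hD, ← sub_mul, mul_assoc,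
      PowerSeries.mul_inv_cancel _ hD0, mul_one] at h5
    exact h5
  have h5 := X_pow_dvd_iff.1 (dvd_sub h2 h4) d (Nat.lt_succ_self d)
  rw [F_eq_coeff le_rfl, ← sub_eq_zero]
  have h6 := X_pow_dvd_iff.1 h2 d (Nat.lt_succ_self d)
  have h7 := X_pow_dvd_iff.1 h4 d (Nat.lt_succ_self d)
  rw [map_sub] at h6 h7
  linear_combination h6 - h7

theorem hasSum_vertexRatio : HasSum
    (fun α : YoungDiagram => PowerSeries.monomial α.card (vertexRatio α))
    (PowerSeries.mk F) := by
  classical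
  -- With discrete coefficients convergence is tested in each degree, where only finitely many
  -- partitions contribute.
  let : TopologicalSpace (LaurentSeries ℚ) := ⊥
  refine (PowerSeries.WithPiTopology.hasSum_iff_hasSum_coeff (LaurentSeries ℚ)).2 fun d => ?_
  rw [PowerSeries.coeff_mk, F]
  have h1 : ∀ α ∈ (finite_card_eq d).toFinset, vertexRatio α =
      PowerSeries.coeff d (PowerSeries.monomial α.card (vertexRatio α)) := by
    intro α hα
    have : α.card = d := (finite_card_eq d).mem_toFinset.1 hα
    rw [PowerSeries.coeff_monomial, if_pos this.symm]
  rw [Finset.sum_congr rfl h1]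
  refine hasSum_sum_of_ne_finset_zero fun α hα => ?_
  rw [PowerSeries.coeff_monomial, if_neg]
  rintro rfl
  exact hα ((finite_card_eq _).mem_toFinset.2 rfl)

theorem hasProd_factor : HasProd factor (PowerSeries.mk F) := by
  let : TopologicalSpace (LaurentSeries ℚ) := ⊥
  refine (PowerSeries.WithPiTopology.tendsto_iff_coeff_tendsto (LaurentSeries ℚ) _ _ _).2
    fun d => ?_
  rw [PowerSeries.coeff_mk]
  -- The coefficient is constant on all finite sets containing `Finset.range d`.
  refine tendsto_const_nhds.congr' ?_
  rw [SummationFilter.unconditional_filter]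
  filter_upwards [Filter.eventually_ge_atTop (Finset.range d)] with s hs
  exact (coeff_prod_factor d s hs).symm

end TopVertex

theorem mainTheorem2 :
    HasSum
      (fun α : YoungDiagram => PowerSeries.monomial α.card (TopVertex.vertexRatio α))
      (PowerSeries.mk TopVertex.F) ∧
    HasProd
      (fun m : ℕ =>
        (1 - (PowerSeries.X : PowerSeries (LaurentSeries ℚ)) ^ (m + 1)) *
          ((1 - PowerSeries.C TopVertex.p * PowerSeries.X ^ (m + 1)) *
            (1 - PowerSeries.C TopVertex.p⁻¹ * PowerSeries.X ^ (m + 1)))⁻¹)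
      (PowerSeries.mk TopVertex.F) :=
  ⟨TopVertex.hasSum_vertexRatio, TopVertex.hasProd_factor⟩
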